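/- **Setting.** Let $V$ be a set of $n$ points with a (pseudo)metric $w$, and let $T=\{(s_1,t_1),\dots,(s_k,t_k)\}\subseteq V\times V$ be $k\ge 1$ terminal pairs. Let $\mathrm{OPT}$ be the minimum of $\sum_{(u,v)\in F}w(u,v)$ over all edge sets $F\subseteq V\times V$ such that $s_j$ and $t_j$ are connected in the undirected graph $(V,F)$ for every $j$. For a threshold $\tau$, a point is *active* if it belongs to a terminal pair $(s_j,t_j)$ with $w(s_j,t_j)\ge\tau$; the *ball graph* $H_\tau$ has the active points as its vertices, and two distinct active points $u,v$ are adjacent iff $w(u,v)<2\tau$. A randomized query algorithm is a probability distribution on deterministic adaptive query algorithms (decision trees); its cost is the maximum number of queries it makes. For $c>1$ and $d\in\mathbb N$ let $T_{\mathrm{MIS}}(n)=T_{\mathrm{MIS}}^{c,d}(n)\ge 1$ be the maximum of $1$ and the least number of queries to the adjacency matrix with which a randomized algorithm outputs, with probability at least $1-n^{-d}$ on every graph $G$ with $n$ vertices, a number $x$ such that $M\le x\le cM$ for the size $M$ of some maximal independent set (MIS) of $G$. **Theorem.** 1. Let $\sigma>0$, $\tau_i=\sigma 2^i$ and $L\ge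 0$, and for $0\le i\le L$ let $M_i$ be the size of any MIS of $H_{\tau_i}$. Then $M_i\tau_i\le\mathrm{OPT}$ for every $i\le L$. Suppose moreover that $\max_j w(s_j,t_j)<\tau_{L+1}$ and that at least one of the following holds: (a) any two distinct points that are active at threshold $\sigma$ are at distance at least $2\sigma$, and $w(s_j,t_j)\ge\sigma$ whenever $s_j\ne t_j$; (b) $\max_j w(s_j,t_j)\ge 4k\sigma$. Then $$\mathrm{OPT}\le 6\sum_{i=0}^{L}M_i\tau_i .$$ 2. There is an absolute constant $A>0$ such that for every $c>1$ and all $\kappa,d\in\mathbb N$ there are constants $C>0$ and $a\in\mathbb N$ with the following property. For all $n$ and all $k$ with $1\le k\le\kappa n$, and all lists $T$ of $k$ terminal pairs in $V=\{1,\dots,n\}$, there is a randomized algorithm that, for every (pseudo)metric $w$ on $V$, makes at most $C\cdot T_{\mathrm{MIS}}^{c,d+1}(n)\cdot\log(k+1)$ queries to the distance matrix of $w$ and, with probability at least $1-n^{-d}$, outputs a number $\mathrm{SOL}$ with $$\mathrm{OPT}\le 6\,\mathrm{SOL}\qquad\text{and}\qquad \mathrm{SOL}\le A\,c\,\log(k+1)\cdot\mathrm{OPT},$$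 where $\mathrm{SOL}=\sum_{i=0}^{L}\hat M_i\tau_i$ with $\tau_i=\frac{X}{4k}\,2^i$, $X=\max_j w(s_j,t_j)$, $L=\lfloor\log_2(4k)\rfloor$, and for every $i$ one has $M_i\le\hat M_i\le cM_i$ for the size $M_i$ of some MIS of $H_{\tau_i}$. Moreover $$T_{\mathrm{MIS}}^{c,d+1}(n)\cdot\log(k+1)\le C\,n^{3/2}\,(\log(n+1))^{a},$$ so the number of queries is $\widetilde O(n^{3/2})$. -/

import Mathlib

namespace SteinerForest

section Instances

variable {V : Type} [Fintype V] {k : ℕ}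

/-- The undirected graph on `V` whose edges are the pairs in `F`. -/
def edgeGraph (F : Finset (V × V)) : SimpleGraph V :=
  SimpleGraph.fromRel (fun u v => (u, v) ∈ F)

/-- `F` is a Steiner forest for the terminal pairs `T`: every pair is connected in `(V, F)`. -/
def Connects (T : Fin k → V × V) (F : Finset (V × V)) : Prop :=
  ∀ j, (edgeGraph F).Reachable (T j).1 (T j).2

/-- The total weight of a set of edges. -/
def weight (w : V → V → ℝ) (F : Finset (V × V)) : ℝ :=
  ∑ e ∈ F, w e.1 e.2

/-- The minimum weight of a Steiner forest on the instance `(V, T, w)`. -/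
noncomputable def opt (w : V → V → ℝ) (T : Fin k → V × V) : ℝ :=
  sInf (weight w '' {F | Connects T F})

/-- The infimum in `opt` is a minimum. -/
theorem isLeast_opt (w : V → V → ℝ) (T : Fin k → V × V) :
    IsLeast (weight w '' {F | Connects T F}) (opt w T) := by
  refine Set.Nonempty.csInf_mem ?_ (Set.toFinite _) |> fun h =>
    ⟨h, fun x hx => csInf_le (Set.toFinite _).bddBelow hx⟩
  refine ⟨_, Finset.univ, fun j => ?_, rfl⟩
  by_cases h : (T j).1 = (T j).2
  · rw [h]
  · exact SimpleGraph.Adj.reachable (by simp [edgeGraph, SimpleGraph.fromRel_adj, h])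

/-- A point `v` is an active terminal at threshold `τ` if it belongs to a terminal pair whose
two points are at distance at least `τ`. -/
def Active (w : V → V → ℝ) (T : Fin k → V × V) (τ : ℝ) (v : V) : Prop :=
  ∃ j, (v = (T j).1 ∨ v = (T j).2) ∧ τ ≤ w (T j).1 (T j).2

/-- The ball graph at threshold `τ`: its vertices are the active terminals, two of them are
adjacent if their balls of radius `τ` collide, i.e. if their distance is less than `2τ`. -/
def ballGraph (w : V → V → ℝ) (T : Fin k → V × V) (τ : ℝ) :
    SimpleGraph {v : V // Active w T τ v} :=
  SimpleGraph.fromRel (fun u v => w u v < 2 * τ)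

/-- The thresholds `τ_i = σ · 2^i`. -/
def threshold (σ : ℝ) (i : ℕ) : ℝ := σ * 2 ^ i

/-- The largest distance `X` of a terminal pair. -/
noncomputable def maxPairDist (w : V → V → ℝ) (T : Fin k → V × V) : ℝ :=
  ⨆ j, w (T j).1 (T j).2

/-- The unit of length `σ = X / (4k)` after scaling. -/
noncomputable def unitLength (w : V → V → ℝ) (T : Fin k → V × V) : ℝ :=
  maxPairDist w T / (4 * k)

/-- The index `L = ⌊log₂ (4k)⌋` of the last threshold. -/
def lastLevel (k : ℕ) : ℕ := Nat.log 2 (4 * k)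

end Instances

/-- `U` is a maximal independent set of `G`. -/
def IsMIS {α : Type} (G : SimpleGraph α) (U : Finset α) : Prop :=
  Maximal (fun S : Finset α => G.IsIndepSet (S : Set α)) U

/-- `x` is a multiplicative `c`-approximation of the size of some MIS of `G`. -/
def IsMISEstimate {α : Type} (c : ℝ) (G : SimpleGraph α) (x : ℝ) : Prop :=
  ∃ U : Finset α, IsMIS G U ∧ (U.card : ℝ) ≤ x ∧ x ≤ c * U.card

/-- `x = ∑_{i ≤ L} M̂_i · τ_i`, where `M̂_i` is a multiplicative `c`-approximation of the size of
some MIS of the ball graph at threshold `τ_i`. -/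
def IsBallEstimate {V : Type} {k : ℕ} (c : ℝ) (w : V → V → ℝ) (T : Fin k → V × V)
    (x : ℝ) : Prop :=
  ∃ Mhat : ℕ → ℝ,
    (∀ i ∈ Finset.range (lastLevel k + 1),
      IsMISEstimate c (ballGraph w T (threshold (unitLength w T) i)) (Mhat i)) ∧
    x = ∑ i ∈ Finset.range (lastLevel k + 1), Mhat i * threshold (unitLength w T) i

/-- Deterministic adaptive query algorithms (decision trees) with access to a matrix indexed by
`V × V` with entries in `A`, and with results in `R`. The next query may depend on all previous
answers. -/
inductive QueryAlg (V A R : Type) : Type where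
  | done (r : R) : QueryAlg V A R
  | query (u v : V) (next : A → QueryAlg V A R) : QueryAlg V A R

/-- The result of a query algorithm on the matrix `O`. -/
def QueryAlg.eval {V A R : Type} (O : V → V → A) : QueryAlg V A R → R
  | .done r => r
  | .query u v next => (next (O u v)).eval O

/-- The number of queries that a query algorithm makes to the matrix `O`. -/
def QueryAlg.queries {V A R : Type} (O : V → V → A) : QueryAlg V A R → ℕ
  | .done _ => 0
  | .query u v next => (next (O u v)).queries O + 1

/-- A randomized query algorithm: a distribution on deterministic query algorithms. -/
abbrev RandAlg (V A R : Type) : Type := PMF (QueryAlg V A R)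

/-- The probability that the result of a randomized query algorithm on the matrix `O`
satisfies `P`. -/
noncomputable def RandAlg.prob {V A R : Type} (𝒜 : RandAlg V A R) (O : V → V → A)
    (P : R → Prop) : ℝ :=
  (PMF.toOuterMeasure 𝒜 {D | P (D.eval O)}).toReal

/-- For all random choices, at most `q` queries are made to the matrix `O`. -/
def RandAlg.QueriesLE {V A R : Type} (𝒜 : RandAlg V A R) (O : V → V → A) (q : ℝ) : Prop :=
  ∀ D ∈ PMF.support 𝒜, (D.queries O : ℝ) ≤ q

open Classical in
/-- The adjacency matrix of a graph. -/
noncomputable def adjOracle {V : Type} (G : SimpleGraph V) (u v : V) : Bool :=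
  decide (G.Adj u v)

/-- `𝒜` computes, with probability at least `1 - δ` on every graph with vertex set `Fin n`, a
multiplicative `c`-approximation of the size of some MIS, with at most `q` queries to the adjacency
matrix. -/
def EstimatesMIS (c δ : ℝ) {n : ℕ} (q : ℕ) (𝒜 : RandAlg (Fin n) Bool ℝ) : Prop :=
  ∀ G : SimpleGraph (Fin n),
    𝒜.QueriesLE (adjOracle G) q ∧ 1 - δ ≤ 𝒜.prob (adjOracle G) (IsMISEstimate c G)

/-- The least number of queries to the adjacency matrix with which a randomized algorithm
computes, with probability at least `1 - δ` on every graph with `n` vertices, a multiplicative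
`c`-approximation of the size of some MIS. -/
noncomputable def misComplexity (c δ : ℝ) (n : ℕ) : ℕ :=
  sInf {q | ∃ 𝒜 : RandAlg (Fin n) Bool ℝ, EstimatesMIS c δ q 𝒜}

/-- The cost `T_MIS` for failure probability `n^{-d}`; every algorithm has cost at least `1`. -/
noncomputable def TMIS (c : ℝ) (d n : ℕ) : ℝ :=
  max 1 (misComplexity c (1 / (n : ℝ) ^ d) n : ℝ)

end SteinerForest

/-!
# Steiner forests and maximal independent sets of ball graphs

**The sandwich.** The points of an independent set of a ball graph are the centres of disjoint balls
of radius `τ`, and each centre has a partner outside its ball. Every Steiner forest therefore spends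
at least `τ` inside each ball; formally, the truncated distances `min (dist u ·) τ` vary by at least
`τ` in total along the forest, while on one edge their variations add up to at most the length of
the edge (`card_mul_le_opt`). For the upper bound a forest is grown level by level. Once every point
active at `τ_i` is connected to one of the `M_i` centres of level `i`, the active points meet at
most `M_i` components, so that at most `M_i` edges suffice both to connect the pairs of this level
(`2 τ_i` each) and to connect the points active at `τ_{i+1}` to their new centres (`4 τ_i` each);
see `exists_level_forest`. In the absence of separation the first level costs at most `4kσ`, and
this is paid for by the last non-empty level, which needs only `2 M τ` of its `6 M τ`
(`opt_le_of_far_pair`).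

**Estimating the size of a maximal independent set.** The set is the greedy one for a random order.
It is computed exactly by a scan if it has fewer than `√n` elements. Otherwise `O(√n log n)` random
vertices are tested for membership, which is enough by a Chernoff bound. A test of `v` examines the
predecessors of `v` in order until a neighbour in the set is found, and tests adjacent
predecessors recursively. The central fact is that the tests of all `n` vertices together make at
most `n²` queries in expectation (`expect_sum_testCost_le`). To see this, the queries are sorted by
their earlier vertex (`totalCost_eq`), and the order is revealed vertex by vertex. With `S` the set
of remaining vertices, the expected number of calls of `u ∈ S` is at most one plus the number of its
neighbours in `S` that survive so far (`expect_calls_le`): if `x` comes next, then `u` loses every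
surviving neighbour that is equal or, `x` surviving, adjacent to `x`, and this loss balances the
calls that `u` receives when it comes next itself (`callBound_step`). In the same way the expected
number of queries still to be made between remaining vertices is at most `|S|` times the number of
survivors in `S` (`expect_innerQueries_le`), because vertices with many surviving neighbours do not
survive for long. A run that exceeds four times its expected number of queries gives up, and
`O(log n)` repetitions make the failure probability polynomially small
(`exists_estimatesMIS_le`).

**The algorithm for Steiner forests.** The distances of the pairs are read; they determine the
active points of all levels. A ball graph is presented to the estimator as a graph on all `n` points, in
which each inactive point is a twin of a fixed active point; the maximal independent sets keep their
sizes (`IsMISEstimate.of_blowUp`). The same random decision tree serves all levels, since the union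
bound does not need independence. Reading the `k ≤ κ n` distances fits into the budget because
`T_MIS(n)` is at least proportional to `n` (`le_TMIS`): with fewer queries the empty graph cannot be
distinguished from a union of cliques on the classes of a random colouring with about `n / (2c)`
colours. If there are more levels than points, then reading the whole matrix is cheap enough.
-/

open scoped ENNReal

namespace SteinerForest

/-! ### The optimum is at least `M τ` -/

section Forests

variable {V : Type}

theorem edgeGraph_mono {F F' : Finset (V × V)} (h : F ⊆ F') : edgeGraph F ≤ edgeGraph F' := by
  intro u v huv
  simp only [edgeGraph, SimpleGraph.fromRel_adj] at huv ⊢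
  exact ⟨huv.1, huv.2.imp (fun a => h a) (fun a => h a)⟩

theorem edgeGraph_reachable_of_mem {F : Finset (V × V)} {e : V × V} (h : e ∈ F) :
    (edgeGraph F).Reachable e.1 e.2 := by
  by_cases he : e.1 = e.2
  · rw [he]
  · exact SimpleGraph.Adj.reachable (by simp [edgeGraph, SimpleGraph.fromRel_adj, he, h])

/-- The increment of a potential between two connected points is at most the total variation of
the potential along the edges. -/
theorem sub_le_sum_of_reachable (F : Finset (V × V)) (g : V → ℝ) {u v : V}
    (h : (edgeGraph F).Reachable u v) : g v - g u ≤ ∑ e ∈ F, |g e.1 - g e.2| := by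
  classical
  obtain ⟨p, hp⟩ := h.exists_isPath
  let δ : Sym2 V → ℝ := Sym2.lift ⟨fun a b => |g a - g b|, fun a b => abs_sub_comm _ _⟩
  have hδ : ∀ s, 0 ≤ δ s := by
    intro s
    induction s with
    | _ a b => exact abs_nonneg _
  have key : ∀ {u v : V} (p : (edgeGraph F).Walk u v), g v - g u ≤ (p.edges.map δ).sum := by
    intro u v p
    induction p with
    | nil => simp
    | @cons a b c hab q ih =>
      have : g b - g a ≤ |g a - g b| := by rw [abs_sub_comm]; exact le_abs_self _
      simp only [SimpleGraph.Walk.edges_cons, List.map_cons, List.sum_cons]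
      have h2 : δ s(a, b) = |g a - g b| := rfl
      rw [h2]; linarith
  calc g v - g u ≤ (p.edges.map δ).sum := key p
    _ = ∑ s ∈ p.edges.toFinset, δ s := (List.sum_toFinset δ hp.isTrail.edges_nodup).symm
    _ ≤ ∑ s ∈ F.image (fun e => s(e.1, e.2)), δ s := by
        refine Finset.sum_le_sum_of_subset_of_nonneg ?_ (fun s _ _ => hδ s)
        intro s hs
        have hs' := p.edges_subset_edgeSet (List.mem_toFinset.1 hs)
        induction s with
        | _ a b =>
          rw [SimpleGraph.mem_edgeSet, edgeGraph, SimpleGraph.fromRel_adj] at hs'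
          rcases hs'.2 with h1 | h1
          · exact Finset.mem_image.2 ⟨_, h1, rfl⟩
          · exact Finset.mem_image.2 ⟨_, h1, Sym2.eq_swap⟩
    _ ≤ ∑ e ∈ F, δ s(e.1, e.2) := Finset.sum_image_le_of_nonneg (fun s _ => hδ _)
    _ = ∑ e ∈ F, |g e.1 - g e.2| := rfl

/-- Truncated distances to the points of a `2τ`-separated set: their variations along one edge add
up to at most the length of the edge, since the balls of radius `τ` are disjoint. -/
theorem sum_abs_truncated_dist_le [PseudoMetricSpace V] {τ : ℝ} (U : Finset V)
    (hU : ∀ u ∈ U, ∀ v ∈ U, u ≠ v → 2 * τ ≤ dist u v) (x y : V) :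
    ∑ u ∈ U, |min (dist u x) τ - min (dist u y) τ| ≤ dist x y := by
  classical
  -- a point lies in at most one of the balls
  have uniq : ∀ z, ∀ u ∈ U, dist u z < τ → ∀ v ∈ U, v ≠ u → τ ≤ dist v z := by
    intro z u hu huz v hv hvu
    have h1 := hU v hv u hu hvu
    have h2 := dist_triangle v z u
    rw [dist_comm z u] at h2
    linarith
  have single : ∀ z, ∃ a, ∑ u ∈ U, (τ - min (dist u z) τ) = a ∧
      (a = 0 ∨ ∃ u ∈ U, dist u z < τ ∧ a = τ - dist u z) := by
    intro z
    refine ⟨_, rfl, ?_⟩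
    by_cases h : ∃ u ∈ U, dist u z < τ
    · obtain ⟨u, hu, huz⟩ := h
      refine Or.inr ⟨u, hu, huz, ?_⟩
      rw [Finset.sum_eq_single_of_mem u hu, min_eq_left huz.le]
      intro v hv hvu
      rw [min_eq_right (uniq z u hu huz v hv hvu), sub_self]
    · push Not at h
      refine Or.inl (Finset.sum_eq_zero fun u hu => ?_)
      rw [min_eq_right (h u hu), sub_self]
  by_cases hb : ∃ u ∈ U, dist u x < τ ∧ dist u y < τ
  · obtain ⟨u, hu, hx, hy⟩ := hb
    rw [Finset.sum_eq_single_of_mem u hu, min_eq_left hx.le, min_eq_left hy.le]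
    · rw [dist_comm u x, dist_comm u y]
      exact abs_dist_sub_le x y u
    · intro v hv hvu
      rw [min_eq_right (uniq x u hu hx v hv hvu), min_eq_right (uniq y u hu hy v hv hvu), sub_self,
        abs_zero]
  · push Not at hb
    obtain ⟨a, ha, ha'⟩ := single x
    obtain ⟨b, hb', hb''⟩ := single y
    have h1 : ∑ u ∈ U, |min (dist u x) τ - min (dist u y) τ| ≤ a + b := by
      rw [← ha, ← hb', ← Finset.sum_add_distrib]
      refine Finset.sum_le_sum fun u hu => ?_
      have i1 := min_le_right (dist u x) τ
      have i2 := min_le_right (dist u y) τ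
      rw [abs_le]; constructor <;> linarith
    refine h1.trans ?_
    rcases ha' with rfl | ⟨u, hu, hux, rfl⟩ <;> rcases hb'' with rfl | ⟨v, hv, hvy, rfl⟩
    · simp
    · have h2 : τ ≤ dist v x := by
        by_contra hcon
        exact absurd hvy (not_lt.2 (hb v hv (not_le.1 hcon)))
      have := dist_triangle v y x
      rw [dist_comm y x] at this
      linarith
    · have := dist_triangle u x y
      have := hb u hu hux
      linarith
    · have huv : u ≠ v := by
        rintro rfl
        exact absurd hvy (not_lt.2 (hb u hu hux))
      have h2 := hU u hu v hv huv
      have h3 := dist_triangle4 u x y v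
      rw [dist_comm y v] at h3
      linarith

variable [Fintype V] {k : ℕ}

/-- Every Steiner forest spends at least `τ` inside each of the disjoint balls of radius `τ` around
the points of an independent set of the ball graph. -/
theorem card_mul_le_opt [PseudoMetricSpace V] (T : Fin k → V × V) {τ : ℝ} (hτ : 0 < τ)
    (U : Finset {v : V // Active dist T τ v})
    (hU : (ballGraph dist T τ).IsIndepSet (U : Set {v : V // Active dist T τ v})) :
    (U.card : ℝ) * τ ≤ opt dist T := by
  classical
  obtain ⟨⟨F, hF, hFw⟩, -⟩ := isLeast_opt (dist : V → V → ℝ) T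
  rw [← hFw]
  have sep : ∀ u ∈ U.map (Function.Embedding.subtype _), ∀ v ∈ U.map (Function.Embedding.subtype _),
      u ≠ v → 2 * τ ≤ dist u v := by
    intro u hu v hv huv
    simp only [Finset.mem_map, Function.Embedding.coe_subtype] at hu hv
    obtain ⟨u, hu, rfl⟩ := hu
    obtain ⟨v, hv, rfl⟩ := hv
    have huv' : u ≠ v := fun h => huv (by rw [h])
    have := hU (Finset.mem_coe.2 hu) (Finset.mem_coe.2 hv) huv'
    simp only [ballGraph, SimpleGraph.fromRel_adj, not_and, not_or, not_lt] at this
    exact (this huv').1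
  have each : ∀ u ∈ U.map (Function.Embedding.subtype _),
      τ ≤ ∑ e ∈ F, |min (dist u e.1) τ - min (dist u e.2) τ| := by
    intro u hu
    simp only [Finset.mem_map, Function.Embedding.coe_subtype] at hu
    obtain ⟨⟨u, j, hj, hjτ⟩, -, rfl⟩ := hu
    have h0 : min (dist u u) τ = 0 := by rw [dist_self]; exact min_eq_left hτ.le
    rcases hj with rfl | rfl
    · have := sub_le_sum_of_reachable F (fun x => min (dist (T j).1 x) τ) (hF j)
      simpa only [h0, min_eq_right hjτ, sub_zero] using this
    · have := sub_le_sum_of_reachable F (fun x => min (dist (T j).2 x) τ) (hF j).symm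
      rw [dist_comm] at hjτ
      simpa only [h0, min_eq_right hjτ, sub_zero] using this
  calc (U.card : ℝ) * τ = ∑ u ∈ U.map (Function.Embedding.subtype _), τ := by simp
    _ ≤ ∑ u ∈ U.map (Function.Embedding.subtype _),
          ∑ e ∈ F, |min (dist u e.1) τ - min (dist u e.2) τ| := Finset.sum_le_sum each
    _ = ∑ e ∈ F, ∑ u ∈ U.map (Function.Embedding.subtype _),
          |min (dist u e.1) τ - min (dist u e.2) τ| := Finset.sum_comm
    _ ≤ ∑ e ∈ F, dist e.1 e.2 :=
        Finset.sum_le_sum fun e _ => sum_abs_truncated_dist_le _ sep e.1 e.2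

end Forests

/-! ### A forest of weight at most `6 ∑ M_i τ_i` -/

section Construction

variable {V : Type}

open Classical in
/-- The number of connected components of `(V, F)` that meet `A`. -/
noncomputable def numComp (F : Finset (V × V)) (A : Finset V) : ℕ :=
  (A.image (edgeGraph F).connectedComponentMk).card

theorem numComp_insert_lt [DecidableEq V] {F : Finset (V × V)} {A : Finset V} {e : V × V}
    (h1 : e.1 ∈ A) (h2 : e.2 ∈ A) (he : ¬ (edgeGraph F).Reachable e.1 e.2) :
    numComp (insert e F) A < numComp F A := by
  classical
  unfold numComp
  have hle := edgeGraph_mono (Finset.subset_insert e F)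
  have himg : A.image (edgeGraph (insert e F)).connectedComponentMk =
      (A.image (edgeGraph F).connectedComponentMk).image
        (SimpleGraph.ConnectedComponent.map (SimpleGraph.Hom.ofLE hle)) := by
    rw [Finset.image_image]
    rfl
  rw [himg]
  refine lt_of_le_of_ne Finset.card_image_le fun hcard => he ?_
  have inj := Finset.card_image_iff.1 hcard
  refine SimpleGraph.ConnectedComponent.eq.1 (inj (Finset.mem_coe.2 (Finset.mem_image_of_mem _ h1))
    (Finset.mem_coe.2 (Finset.mem_image_of_mem _ h2)) ?_)
  exact SimpleGraph.ConnectedComponent.eq.2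
    (edgeGraph_reachable_of_mem (Finset.mem_insert_self e F))

theorem numComp_le_card {F : Finset (V × V)} {A C : Finset V}
    (h : ∀ a ∈ A, ∃ c ∈ C, (edgeGraph F).Reachable a c) : numComp F A ≤ C.card := by
  classical
  refine (Finset.card_le_card ?_).trans
    (Finset.card_image_le (s := C) (f := (edgeGraph F).connectedComponentMk))
  intro x hx
  obtain ⟨a, ha, rfl⟩ := Finset.mem_image.1 hx
  obtain ⟨c, hc, hac⟩ := h a ha
  exact Finset.mem_image.2 ⟨c, hc, (SimpleGraph.ConnectedComponent.eq.2 hac).symm⟩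

/-- Pairs of points of `A` can be connected at the price of `b` per component that meets `A`: an
edge is bought only if it merges two components. -/
theorem exists_connecting_superset {w : V → V → ℝ} {b : ℝ} (hb : 0 ≤ b) (A : Finset V)
    (E : Finset (V × V))
    (hE : ∀ e ∈ E, e.1 ∈ A ∧ e.2 ∈ A ∧ w e.1 e.2 ≤ b) (F : Finset (V × V)) :
    ∃ F', F ⊆ F' ∧ (∀ e ∈ E, (edgeGraph F').Reachable e.1 e.2) ∧
      weight w F' + b * numComp F' A ≤ weight w F + b * numComp F A := by
  classical
  induction E using Finset.induction_on with
  | empty => exact ⟨F, subset_rfl, by simp, le_rfl⟩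
  | insert e E heE ih =>
    obtain ⟨F₁, hF₁, hr, hw⟩ := ih fun e he => hE e (Finset.mem_insert_of_mem he)
    by_cases hre : (edgeGraph F₁).Reachable e.1 e.2
    · refine ⟨F₁, hF₁, fun e' he' => ?_, hw⟩
      rcases Finset.mem_insert.1 he' with rfl | h
      exacts [hre, hr e' h]
    · obtain ⟨h1, h2, hb⟩ := hE e (Finset.mem_insert_self e E)
      have hnot : e ∉ F₁ := fun h => hre (edgeGraph_reachable_of_mem h)
      refine ⟨insert e F₁, hF₁.trans (Finset.subset_insert _ _), fun e' he' => ?_, ?_⟩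
      · rcases Finset.mem_insert.1 he' with rfl | h
        · exact edgeGraph_reachable_of_mem (Finset.mem_insert_self _ _)
        · exact (hr e' h).mono (edgeGraph_mono (Finset.subset_insert _ _))
      · have hlt : (numComp (insert e F₁) A : ℝ) + 1 ≤ numComp F₁ A := by
          exact_mod_cast numComp_insert_lt h1 h2 hre
        have : weight w (insert e F₁) = w e.1 e.2 + weight w F₁ := Finset.sum_insert hnot
        rw [this]
        nlinarith

theorem IsMIS.exists_adj_of_notMem {α : Type} {G : SimpleGraph α} {U : Finset α} (h : IsMIS G U)
    {v : α} (hv : v ∉ U) : ∃ u ∈ U, G.Adj v u := by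
  classical
  by_contra! hcon
  have hins : G.IsIndepSet ((insert v U : Finset α) : Set α) := by
    rw [Finset.coe_insert]
    exact Set.pairwise_insert.2 ⟨h.prop, fun u hu _ =>
      ⟨hcon u hu, fun hadj => hcon u hu hadj.symm⟩⟩
  exact hv (h.le_of_ge hins (Finset.subset_insert v U) (Finset.mem_insert_self v U))

theorem weight_union_le [DecidableEq V] {w : V → V → ℝ} (hw : ∀ u v, 0 ≤ w u v)
    (F F' : Finset (V × V)) : weight w (F ∪ F') ≤ weight w F + weight w F' := by
  unfold weight
  rw [← Finset.sum_union_inter]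
  exact le_add_of_nonneg_right (Finset.sum_nonneg fun _ _ => hw _ _)

theorem weight_biUnion_le [DecidableEq V] {ι : Type} [DecidableEq ι] {w : V → V → ℝ}
    (hw : ∀ u v, 0 ≤ w u v) (I : Finset ι) (S : ι → Finset (V × V)) :
    weight w (I.biUnion S) ≤ ∑ i ∈ I, weight w (S i) := by
  induction I using Finset.induction_on with
  | empty => simp [weight]
  | insert i I hi ih =>
    rw [Finset.biUnion_insert, Finset.sum_insert hi]
    exact (weight_union_le hw _ _).trans (by linarith)

variable {k : ℕ}

theorem Active.anti {w : V → V → ℝ} {T : Fin k → V × V} {τ τ' : ℝ} (h : τ ≤ τ') {v : V}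
    (hv : Active w T τ' v) : Active w T τ v := by
  obtain ⟨j, hj, hw⟩ := hv
  exact ⟨j, hj, h.trans hw⟩

theorem IsMIS.exists_dist_lt [PseudoMetricSpace V] {T : Fin k → V × V} {τ : ℝ} (hτ : 0 < τ)
    {U : Finset {v : V // Active dist T τ v}} (hU : IsMIS (ballGraph dist T τ) U) {v : V}
    (hv : Active dist T τ v) : ∃ c ∈ U, dist v c < 2 * τ := by
  by_cases h : (⟨v, hv⟩ : {v : V // Active dist T τ v}) ∈ U
  · exact ⟨_, h, by simpa using hτ⟩
  · obtain ⟨u, hu, hadj⟩ := hU.exists_adj_of_notMem h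
    refine ⟨u, hu, ?_⟩
    simp only [ballGraph, SimpleGraph.fromRel_adj] at hadj
    rcases hadj.2 with h | h
    · exact h
    · rwa [dist_comm] at h

variable [Fintype V]

theorem opt_le_weight {w : V → V → ℝ} {T : Fin k → V × V} {F : Finset (V × V)}
    (h : Connects T F) : opt w T ≤ weight w F :=
  (isLeast_opt w T).2 ⟨F, h, rfl⟩

theorem threshold_pos {σ : ℝ} (hσ : 0 < σ) (i : ℕ) : 0 < threshold σ i := by
  unfold threshold; positivity

theorem threshold_succ (σ : ℝ) (i : ℕ) : threshold σ (i + 1) = 2 * threshold σ i := by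
  unfold threshold; ring

open Classical in
/-- The set of active points, as a finite set. -/
noncomputable def activeSet (w : V → V → ℝ) (T : Fin k → V × V) (τ : ℝ) : Finset V :=
  Finset.univ.filter (Active w T τ)

theorem mem_activeSet {w : V → V → ℝ} {T : Fin k → V × V} {τ : ℝ} {v : V} :
    v ∈ activeSet w T τ ↔ Active w T τ v := by
  simp [activeSet]

variable [PseudoMetricSpace V] {T : Fin k → V × V}

theorem numComp_activeSet_le {τ : ℝ} {U : Finset {v : V // Active dist T τ v}}
    {F : Finset (V × V)} (h : ∀ u, Active dist T τ u → ∃ c ∈ U, (edgeGraph F).Reachable u c)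
    {A : Finset V} (hA : A ⊆ activeSet dist T τ) : numComp F A ≤ U.card := by
  classical
  rw [← Finset.card_map (Function.Embedding.subtype _)]
  refine numComp_le_card fun a ha => ?_
  obtain ⟨c, hc, hr⟩ := h a (mem_activeSet.1 (hA ha))
  exact ⟨c, Finset.mem_map_of_mem (Function.Embedding.subtype _) hc, hr⟩

/-- If every point active at threshold `τ` is connected to one of the centres `U`, then the pairs at
distances between `τ` and `2τ` can be connected at the price of `2τ` per centre. -/
theorem exists_connecting_pairs {τ : ℝ} (hτ : 0 ≤ τ) {U : Finset {v : V // Active dist T τ v}}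
    {F : Finset (V × V)} (h : ∀ u, Active dist T τ u → ∃ c ∈ U, (edgeGraph F).Reachable u c)
    (hT : ∀ j, dist (T j).1 (T j).2 < τ → (edgeGraph F).Reachable (T j).1 (T j).2) :
    ∃ F', F ⊆ F' ∧
      (∀ j, dist (T j).1 (T j).2 < 2 * τ → (edgeGraph F').Reachable (T j).1 (T j).2) ∧
      weight dist F' ≤ weight dist F + 2 * τ * U.card := by
  classical
  obtain ⟨F', hF, hr, hw⟩ := exists_connecting_superset (w := dist) (b := 2 * τ) (by linarith)
    (activeSet dist T τ)
    ((Finset.univ.filter fun j => τ ≤ dist (T j).1 (T j).2 ∧ dist (T j).1 (T j).2 < 2 * τ).image T)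
    (by
      intro e he
      obtain ⟨j, hj, rfl⟩ := Finset.mem_image.1 he
      obtain ⟨-, hj1, hj2⟩ := Finset.mem_filter.1 hj
      exact ⟨mem_activeSet.2 ⟨j, Or.inl rfl, hj1⟩, mem_activeSet.2 ⟨j, Or.inr rfl, hj1⟩, hj2.le⟩) F
  refine ⟨F', hF, fun j hj => ?_, ?_⟩
  · by_cases hj1 : τ ≤ dist (T j).1 (T j).2
    · exact hr _ (Finset.mem_image.2 ⟨j, by simp [hj1, hj], rfl⟩)
    · exact (hT j (not_le.1 hj1)).mono (edgeGraph_mono hF)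
  · have h1 : (numComp F (activeSet dist T τ) : ℝ) ≤ U.card := by
      exact_mod_cast numComp_activeSet_le h subset_rfl
    have h2 : (0 : ℝ) ≤ numComp F' (activeSet dist T τ) := by positivity
    nlinarith

/-- Climbing the levels: a forest that serves the first level extends, at the price of `6 M_i τ_i`
per level passed, to a forest that connects all active points of level `i` to their centres and
all pairs at distances below `τ_i`. -/
theorem exists_level_forest {σ : ℝ} (hσ : 0 < σ) (L : ℕ)
    (U : (i : ℕ) → Finset {v : V // Active dist T (threshold σ i) v})
    (hU : ∀ i ≤ L, IsMIS (ballGraph dist T (threshold σ i)) (U i)) (F₀ : Finset (V × V))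
    (h₀ : ∀ u, Active dist T (threshold σ 0) u → ∃ c ∈ U 0, (edgeGraph F₀).Reachable u c)
    (hT₀ : ∀ j, dist (T j).1 (T j).2 < threshold σ 0 →
      (edgeGraph F₀).Reachable (T j).1 (T j).2) (i : ℕ) (hi : i ≤ L) :
    ∃ F, (∀ u, Active dist T (threshold σ i) u → ∃ c ∈ U i, (edgeGraph F).Reachable u c) ∧
      (∀ j, dist (T j).1 (T j).2 < threshold σ i → (edgeGraph F).Reachable (T j).1 (T j).2) ∧
      weight dist F
        ≤ weight dist F₀ + 6 * ∑ i ∈ Finset.range i, (U i).card * threshold σ i := by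
  classical
  induction i with
  | zero => exact ⟨F₀, h₀, hT₀, by simp⟩
  | succ i ih =>
    obtain ⟨F, hF, hTF, hw⟩ := ih (by omega)
    have hτ := threshold_pos hσ i
    have hτ' := threshold_pos hσ (i + 1)
    have hsucc := threshold_succ σ i
    obtain ⟨F', hFF', hTF', hw'⟩ := exists_connecting_pairs hτ.le hF hTF
    have hsub : activeSet dist T (threshold σ (i + 1)) ⊆ activeSet dist T (threshold σ i) := by
      intro v hv
      exact mem_activeSet.2 ((mem_activeSet.1 hv).anti (by linarith))
    have hcomp : numComp F' (activeSet dist T (threshold σ (i + 1))) ≤ (U i).card := by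
      refine numComp_activeSet_le (fun u hu => ?_) hsub
      obtain ⟨c, hc, hr⟩ := hF u hu
      exact ⟨c, hc, hr.mono (edgeGraph_mono hFF')⟩
    obtain ⟨F'', hF'', hr'', hw''⟩ := exists_connecting_superset (w := dist)
      (b := 2 * threshold σ (i + 1)) (by linarith) (activeSet dist T (threshold σ (i + 1)))
      (Finset.univ.filter fun e : V × V => e.1 ∈ activeSet dist T (threshold σ (i + 1)) ∧
        e.2 ∈ activeSet dist T (threshold σ (i + 1)) ∧ dist e.1 e.2 ≤ 2 * threshold σ (i + 1))
      (by simp) F'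
    refine ⟨F'', fun u hu => ?_, fun j hj => ?_, ?_⟩
    · obtain ⟨c, hc, hd⟩ := (hU (i + 1) hi).exists_dist_lt hτ' hu
      refine ⟨c, hc, hr'' (u, c) ?_⟩
      simp only [Finset.mem_filter, Finset.mem_univ, true_and]
      exact ⟨mem_activeSet.2 hu, mem_activeSet.2 c.2, hd.le⟩
    · exact (hTF' j (by linarith)).mono (edgeGraph_mono hF'')
    · have h1 : (numComp F' (activeSet dist T (threshold σ (i + 1))) : ℝ) ≤ (U i).card := by
        exact_mod_cast hcomp
      have h2 : (0 : ℝ) ≤ numComp F'' (activeSet dist T (threshold σ (i + 1))) := by positivity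
      rw [Finset.sum_range_succ, mul_add]
      nlinarith

theorem opt_le_of_level_zero {σ : ℝ} (hσ : 0 < σ) (L : ℕ)
    (U : (i : ℕ) → Finset {v : V // Active dist T (threshold σ i) v})
    (hU : ∀ i ≤ L, IsMIS (ballGraph dist T (threshold σ i)) (U i)) (F₀ : Finset (V × V))
    (h₀ : ∀ u, Active dist T (threshold σ 0) u → ∃ c ∈ U 0, (edgeGraph F₀).Reachable u c)
    (hT₀ : ∀ j, dist (T j).1 (T j).2 < threshold σ 0 →
      (edgeGraph F₀).Reachable (T j).1 (T j).2)
    (hL : ∀ j, dist (T j).1 (T j).2 < threshold σ (L + 1)) :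
    opt dist T + 4 * ((U L).card * threshold σ L) ≤ weight dist F₀
      + 6 * ∑ i ∈ Finset.range (L + 1), (U i).card * threshold σ i := by
  obtain ⟨F, hF, hTF, hw⟩ := exists_level_forest hσ L U hU F₀ h₀ hT₀ L le_rfl
  obtain ⟨F', -, hTF', hw'⟩ := exists_connecting_pairs (threshold_pos hσ L).le hF hTF
  have := opt_le_weight (w := dist) (T := T) (F := F') fun j =>
    hTF' j (by rw [← threshold_succ]; exact hL j)
  rw [Finset.sum_range_succ, mul_add]
  linarith

/-- The upper bound when the points active at threshold `σ` are `2σ`-separated: the empty forest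
serves the first level. -/
theorem opt_le_of_separated {σ : ℝ} (hσ : 0 < σ) (L : ℕ)
    (U : (i : ℕ) → Finset {v : V // Active dist T (threshold σ i) v})
    (hU : ∀ i ≤ L, IsMIS (ballGraph dist T (threshold σ i)) (U i))
    (hL : ∀ j, dist (T j).1 (T j).2 < threshold σ (L + 1))
    (hsep : ∀ u v, u ≠ v → Active dist T σ u → Active dist T σ v → 2 * σ ≤ dist u v)
    (hT : ∀ j, (T j).1 ≠ (T j).2 → σ ≤ dist (T j).1 (T j).2) :
    opt dist T ≤ 6 * ∑ i ∈ Finset.range (L + 1), (U i).card * threshold σ i := by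
  have h0 : threshold σ 0 = σ := by simp [threshold]
  have key := opt_le_of_level_zero hσ L U hU ∅ ?_ ?_ hL
  · have : 0 ≤ ((U L).card : ℝ) * threshold σ L := by
      have := threshold_pos hσ L
      positivity
    simp only [weight, Finset.sum_empty] at key
    linarith
  · intro u hu
    obtain ⟨c, hc, hd⟩ := (hU 0 (Nat.zero_le L)).exists_dist_lt (threshold_pos hσ 0) hu
    refine ⟨c, hc, ?_⟩
    by_cases huc : u = c.1
    · rw [huc]
    · exact absurd (hsep u c huc (hu.anti h0.ge) (c.2.anti h0.ge)) (not_le.2 (by linarith))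
  · intro j hj
    rw [h0] at hj
    by_cases hj' : (T j).1 = (T j).2
    · rw [hj']
    · exact absurd (hT j hj') (not_le.2 hj)

/-- The upper bound when some pair has distance at least `4kσ`: the pairs below the first threshold
and the edges to the centres of the first level cost at most `4kσ`, which is paid for by the
slack of the last non-empty level. -/
theorem opt_le_of_far_pair {σ : ℝ} (hσ : 0 < σ) (L : ℕ)
    (U : (i : ℕ) → Finset {v : V // Active dist T (threshold σ i) v})
    (hU : ∀ i ≤ L, IsMIS (ballGraph dist T (threshold σ i)) (U i))
    (hL : ∀ j, dist (T j).1 (T j).2 < threshold σ (L + 1))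
    (hfar : ∃ j, 4 * k * σ ≤ dist (T j).1 (T j).2) :
    opt dist T ≤ 6 * ∑ i ∈ Finset.range (L + 1), (U i).card * threshold σ i := by
  classical
  obtain ⟨j₀, hj₀⟩ := hfar
  have h0 : threshold σ 0 = σ := by simp [threshold]
  have hk : (1 : ℝ) ≤ k := by exact_mod_cast (Fin.pos j₀)
  -- the last level with an active point
  let Q : ℕ → Prop := fun i => ∃ j, threshold σ i ≤ dist (T j).1 (T j).2
  have hQ0 : Q 0 := ⟨j₀, by rw [h0]; nlinarith⟩
  set L' := Nat.findGreatest Q L with hL'def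
  have hL'L : L' ≤ L := Nat.findGreatest_le L
  obtain ⟨j₁, hj₁⟩ : Q L' := Nat.findGreatest_spec (Nat.zero_le L) hQ0
  have hmax : ∀ j, dist (T j).1 (T j).2 < threshold σ (L' + 1) := by
    intro j
    by_contra! hcon
    rcases hL'L.lt_or_eq with h | h
    · exact Nat.findGreatest_is_greatest (Nat.lt_succ_self L') h ⟨j, hcon⟩
    · rw [h] at hcon
      exact absurd (hL j) (not_lt.2 hcon)
  have hcentre : ∀ u : V, ∃ c : V, Active dist T σ u →
      dist u c < 2 * σ ∧ ∃ c' ∈ U 0, (c' : V) = c := by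
    intro u
    by_cases hu : Active dist T σ u
    · obtain ⟨c, hc, hd⟩ := (hU 0 (Nat.zero_le L)).exists_dist_lt (threshold_pos hσ 0)
        (v := u) (by rwa [h0])
      exact ⟨c, fun _ => ⟨by linarith, c, hc, rfl⟩⟩
    · exact ⟨u, fun h => absurd h hu⟩
  choose c hc using hcentre
  -- the edges that serve one pair at the first level
  let S : Fin k → Finset (V × V) := fun j =>
    if σ ≤ dist (T j).1 (T j).2 then {((T j).1, c (T j).1), ((T j).2, c (T j).2)} else {T j}
  have hS : ∀ j, weight dist (S j) ≤ 4 * σ := by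
    intro j
    by_cases hj : σ ≤ dist (T j).1 (T j).2
    · have h1 := (hc (T j).1 ⟨j, Or.inl rfl, hj⟩).1
      have h2 := (hc (T j).2 ⟨j, Or.inr rfl, hj⟩).1
      have hSj : S j = {((T j).1, c (T j).1)} ∪ {((T j).2, c (T j).2)} := by
        simp only [S, if_pos hj]; rfl
      rw [hSj]
      refine (weight_union_le (fun _ _ => dist_nonneg) _ _).trans ?_
      simp only [weight, Finset.sum_singleton]
      linarith
    · simp only [S, if_neg hj, weight, Finset.sum_singleton]
      linarith [not_le.1 hj]
  have hF₀ : weight dist (Finset.univ.biUnion S) ≤ 4 * k * σ := by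
    calc weight dist (Finset.univ.biUnion S) ≤ ∑ j, weight dist (S j) :=
          weight_biUnion_le (fun _ _ => dist_nonneg) _ _
      _ ≤ ∑ j : Fin k, 4 * σ := Finset.sum_le_sum fun j _ => hS j
      _ = 4 * k * σ := by simp; ring
  have key := opt_le_of_level_zero hσ L' U (fun i hi => hU i (hi.trans hL'L))
    (Finset.univ.biUnion S) ?_ ?_ hmax
  · have hne : (1 : ℝ) ≤ (U L').card := by
      obtain ⟨c, hc, -⟩ := (hU L' hL'L).exists_dist_lt (threshold_pos hσ L')
        (v := (T j₁).1) ⟨j₁, Or.inl rfl, hj₁⟩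
      exact_mod_cast Finset.card_pos.2 ⟨c, hc⟩
    have h1 := hmax j₀
    rw [threshold_succ] at h1
    have h2 := threshold_pos hσ L'
    have h3 : ∑ i ∈ Finset.range (L' + 1), ((U i).card : ℝ) * threshold σ i ≤
        ∑ i ∈ Finset.range (L + 1), ((U i).card : ℝ) * threshold σ i := by
      refine Finset.sum_le_sum_of_subset_of_nonneg
        (Finset.range_subset_range.2 (by omega)) fun i _ _ => ?_
      have := threshold_pos hσ i
      positivity
    nlinarith
  · intro u hu
    rw [h0] at hu
    obtain ⟨c', hc', hcc⟩ := (hc u hu).2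
    refine ⟨c', hc', ?_⟩
    rw [hcc]
    obtain ⟨j, hj, hw⟩ := hu
    refine edgeGraph_reachable_of_mem (e := (u, c u))
      (Finset.mem_biUnion.2 ⟨j, Finset.mem_univ j, ?_⟩)
    simp only [S, if_pos hw]
    rcases hj with rfl | rfl <;> simp
  · intro j hj
    rw [h0] at hj
    refine edgeGraph_reachable_of_mem (Finset.mem_biUnion.2 ⟨j, Finset.mem_univ j, ?_⟩)
    simp only [S, if_neg (not_le.2 hj), Finset.mem_singleton]

end Construction

/-! ### Combinators for query algorithms -/

section QueryAlgorithms

variable {V V' A B R S : Type}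

/-- Sequential composition of query algorithms. -/
def QueryAlg.bind : QueryAlg V A R → (R → QueryAlg V A S) → QueryAlg V A S
  | .done r, f => f r
  | .query u v next, f => .query u v fun a => (next a).bind f

theorem QueryAlg.eval_bind (O : V → V → A) (D : QueryAlg V A R) (f : R → QueryAlg V A S) :
    (D.bind f).eval O = (f (D.eval O)).eval O := by
  induction D with
  | done r => rfl
  | query u v next ih => exact ih (O u v)

theorem QueryAlg.queries_bind (O : V → V → A) (D : QueryAlg V A R) (f : R → QueryAlg V A S) :
    (D.bind f).queries O = D.queries O + (f (D.eval O)).queries O := by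
  induction D with
  | done r => simp [bind, queries, eval]
  | query u v next ih =>
    simp only [bind, queries, eval, ih (O u v)]
    omega

/-- Run a query algorithm for at most `q` queries; the result is `none` if it needs more. -/
def QueryAlg.truncate : ℕ → QueryAlg V A R → QueryAlg V A (Option R)
  | _, .done r => .done (some r)
  | 0, .query _ _ _ => .done none
  | q + 1, .query u v next => .query u v fun a => (next a).truncate q

theorem QueryAlg.eval_truncate (O : V → V → A) (D : QueryAlg V A R) (q : ℕ) :
    (D.truncate q).eval O = if D.queries O ≤ q then some (D.eval O) else none := by
  induction D generalizing q with
  | done r => cases q <;> simp [truncate, eval, queries]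
  | query u v next ih =>
    cases q with
    | zero => simp [truncate, eval, queries]
    | succ q => simp [truncate, eval, queries, ih]

theorem QueryAlg.queries_truncate_le (O : V → V → A) (D : QueryAlg V A R) (q : ℕ) :
    (D.truncate q).queries O ≤ q := by
  induction D generalizing q with
  | done r => cases q <;> simp [truncate, queries]
  | query u v next ih =>
    cases q with
    | zero => simp [truncate, queries]
    | succ q => simpa [truncate, queries] using ih (O u v) q

/-- Run a query algorithm for a matrix with entries in `B` on a matrix with entries in `A`: the
entry `(u, v)` is obtained by applying `dec u v` to the entry at `(φ u, φ v)`. -/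
def QueryAlg.simulate (φ : V → V') (dec : V → V → A → B) : QueryAlg V B R → QueryAlg V' A R
  | .done r => .done r
  | .query u v next => .query (φ u) (φ v) fun a => (next (dec u v a)).simulate φ dec

theorem QueryAlg.eval_simulate (φ : V → V') (dec : V → V → A → B) (O : V' → V' → A)
    (D : QueryAlg V B R) :
    (D.simulate φ dec).eval O = D.eval fun u v => dec u v (O (φ u) (φ v)) := by
  induction D with
  | done r => rfl
  | query u v next ih => exact ih _

theorem QueryAlg.queries_simulate (φ : V → V') (dec : V → V → A → B) (O : V' → V' → A)
    (D : QueryAlg V B R) :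
    (D.simulate φ dec).queries O = D.queries fun u v => dec u v (O (φ u) (φ v)) := by
  induction D with
  | done r => rfl
  | query u v next ih => simp [simulate, queries, ih]

open Classical in
/-- Read the entries of a matrix at a list of positions. The result is a matrix with the same
entries there; its other entries are irrelevant. -/
noncomputable def readAt : List (V × V) → (V → V → A) → QueryAlg V A (V → V → A)
  | [], W => .done W
  | e :: l, W => .query e.1 e.2 fun a =>
      readAt l (Function.update W e.1 (Function.update (W e.1) e.2 a))

theorem queries_readAt (O : V → V → A) (l : List (V × V)) (W : V → V → A) :
    (readAt l W).queries O = l.length := by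
  induction l generalizing W with
  | nil => rfl
  | cons e l ih => simp [readAt, QueryAlg.queries, ih]

theorem eval_readAt_of_eq (O : V → V → A) (l : List (V × V)) (W : V → V → A) (e : V × V)
    (h : W e.1 e.2 = O e.1 e.2) : (readAt l W).eval O e.1 e.2 = O e.1 e.2 := by
  classical
  induction l generalizing W with
  | nil => exact h
  | cons e' l ih =>
    refine ih _ ?_
    by_cases h1 : e.1 = e'.1
    · by_cases h2 : e.2 = e'.2
      · simp [h1, h2]
      · rw [h1, Function.update_self, Function.update_of_ne h2, ← h1, h]
    · rw [Function.update_of_ne h1, h]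

theorem eval_readAt (O : V → V → A) (l : List (V × V)) (W : V → V → A) (e : V × V)
    (he : e ∈ l) : (readAt l W).eval O e.1 e.2 = O e.1 e.2 := by
  classical
  induction l generalizing W with
  | nil => simp at he
  | cons e' l ih =>
    by_cases h : e ∈ l
    · exact ih _ h
    · obtain rfl : e = e' := by simpa [h] using he
      exact eval_readAt_of_eq O l _ e (by simp)

end QueryAlgorithms

/-! ### Expectations over random choices -/

section Expectation

variable {α β : Type}

/-- The expectation of a non-negative function. -/
noncomputable def expect (p : PMF α) (f : α → ℝ≥0∞) : ℝ≥0∞ := ∑' a, p a * f a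

theorem expect_pure (a : α) (f : α → ℝ≥0∞) : expect (PMF.pure a) f = f a := by
  classical
  unfold expect
  rw [tsum_eq_single a]
  · simp
  · intro b hb
    simp [PMF.pure_apply, hb]

theorem expect_bind (p : PMF α) (g : α → PMF β) (f : β → ℝ≥0∞) :
    expect (p.bind g) f = expect p fun a => expect (g a) f := by
  unfold expect
  simp_rw [PMF.bind_apply, ← ENNReal.tsum_mul_right, ← ENNReal.tsum_mul_left]
  rw [ENNReal.tsum_comm]
  simp_rw [mul_assoc]

theorem expect_map (p : PMF α) (g : α → β) (f : β → ℝ≥0∞) :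
    expect (p.map g) f = expect p fun a => f (g a) := by
  rw [← PMF.bind_pure_comp, expect_bind]
  simp [expect_pure]

theorem expect_mono (p : PMF α) {f g : α → ℝ≥0∞} (h : ∀ a ∈ p.support, f a ≤ g a) :
    expect p f ≤ expect p g := by
  refine ENNReal.tsum_le_tsum fun a => ?_
  by_cases ha : p a = 0
  · simp [ha]
  · exact mul_le_mul_right (h a ((PMF.mem_support_iff p a).2 ha)) _

theorem expect_add (p : PMF α) (f g : α → ℝ≥0∞) :
    expect p (fun a => f a + g a) = expect p f + expect p g := by
  simp only [expect, mul_add, ENNReal.tsum_add]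

theorem expect_const_mul (p : PMF α) (c : ℝ≥0∞) (f : α → ℝ≥0∞) :
    expect p (fun a => c * f a) = c * expect p f := by
  simp only [expect, ← ENNReal.tsum_mul_left]
  exact tsum_congr fun a => by ring

theorem expect_const (p : PMF α) (c : ℝ≥0∞) : expect p (fun _ => c) = c := by
  simp [expect, ENNReal.tsum_mul_right, p.tsum_coe]

theorem expect_sum {ι : Type} (p : PMF α) (s : Finset ι) (f : ι → α → ℝ≥0∞) :
    expect p (fun a => ∑ i ∈ s, f i a) = ∑ i ∈ s, expect p (f i) := by
  classical
  induction s using Finset.induction_on with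
  | empty => simp [expect]
  | insert i s hi ih =>
    simp only [Finset.sum_insert hi, expect_add, ih]

theorem expect_uniformOfFinset (s : Finset α) (hs : s.Nonempty) (f : α → ℝ≥0∞) :
    expect (PMF.uniformOfFinset s hs) f = (∑ a ∈ s, f a) / s.card := by
  unfold expect
  rw [tsum_eq_sum (s := s)]
  · rw [div_eq_mul_inv, Finset.sum_mul]
    exact Finset.sum_congr rfl fun a ha => by
      rw [PMF.uniformOfFinset_apply_of_mem hs ha, mul_comm]
  · intro a ha
    rw [PMF.uniformOfFinset_apply_of_notMem hs ha, zero_mul]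

open Classical in
/-- Markov's inequality. -/
theorem expect_indicator_le_div (p : PMF α) (f : α → ℝ≥0∞) {t : ℝ≥0∞} (ht0 : t ≠ 0)
    (ht : t ≠ ⊤) : expect p (fun a => if t ≤ f a then 1 else 0) ≤ expect p f / t := by
  rw [ENNReal.le_div_iff_mul_le (Or.inl ht0) (Or.inl ht), mul_comm, ← expect_const_mul]
  refine expect_mono p fun a _ => ?_
  split_ifs with h
  · simpa using h
  · simp

end Expectation

/-! ### Failure probabilities -/

section Failure

variable {V A R : Type}

open Classical in
/-- The probability that the result of a randomized query algorithm violates `P`, as an expectation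
over the deterministic algorithms. -/
noncomputable def failProb (𝒜 : RandAlg V A R) (O : V → V → A) (P : R → Prop) : ℝ≥0∞ :=
  expect 𝒜 fun D => if P (D.eval O) then 0 else 1

theorem ofReal_prob_add_failProb (𝒜 : RandAlg V A R) (O : V → V → A) (P : R → Prop) :
    ENNReal.ofReal (𝒜.prob O P) + failProb 𝒜 O P = 1 := by
  classical
  have h1 : ENNReal.ofReal (𝒜.prob O P) = expect 𝒜 fun D => if P (D.eval O) then 1 else 0 := by
    rw [RandAlg.prob, PMF.toOuterMeasure_apply, ENNReal.ofReal_toReal]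
    · unfold expect
      refine tsum_congr fun D => ?_
      by_cases h : P (D.eval O) <;> simp [Set.indicator, h]
    · refine ne_top_of_le_ne_top ENNReal.one_ne_top ?_
      rw [← PMF.tsum_coe 𝒜]
      exact ENNReal.tsum_le_tsum fun D => Set.indicator_le_self _ _ _
  rw [h1, failProb, ← expect_add]
  convert expect_const 𝒜 1 using 2
  funext D
  split_ifs <;> simp

theorem prob_nonneg (𝒜 : RandAlg V A R) (O : V → V → A) (P : R → Prop) : 0 ≤ 𝒜.prob O P :=
  ENNReal.toReal_nonneg

theorem one_sub_le_prob_iff (𝒜 : RandAlg V A R) (O : V → V → A) (P : R → Prop) {δ : ℝ}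
    (hδ : 0 ≤ δ) : 1 - δ ≤ 𝒜.prob O P ↔ failProb 𝒜 O P ≤ ENNReal.ofReal δ := by
  have h := ofReal_prob_add_failProb 𝒜 O P
  have h0 := prob_nonneg 𝒜 O P
  have hne : failProb 𝒜 O P ≠ ⊤ := fun htop => by simp [htop] at h
  have h2 : 𝒜.prob O P + (failProb 𝒜 O P).toReal = 1 := by
    have := congrArg ENNReal.toReal h
    rwa [ENNReal.toReal_add ENNReal.ofReal_ne_top hne, ENNReal.toReal_ofReal h0,
      ENNReal.toReal_one] at this
  rw [ENNReal.le_ofReal_iff_toReal_le hne hδ]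
  constructor <;> intro <;> linarith

theorem failProb_le_one (𝒜 : RandAlg V A R) (O : V → V → A) (P : R → Prop) :
    failProb 𝒜 O P ≤ 1 := by
  rw [← ofReal_prob_add_failProb 𝒜 O P]
  exact le_add_self

end Failure

/-! ### The greedy maximal independent set and the cost of testing membership -/

section Greedy

open Classical

variable {V : Type} (G : SimpleGraph V)

/-- `v` has no neighbour in the greedy independent set of the vertices `r`, which are listed in the
reverse of the order in which they are processed. -/
def Survives : List V → V → Prop
  | [], _ => True
  | x :: r, v => Survives r v ∧ ¬ (G.Adj v x ∧ Survives r x)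

/-- The greedy independent set of a list, processed from its end. -/
noncomputable def greedySet : List V → Finset V
  | [] => ∅
  | x :: r => if Survives G r x then insert x (greedySet r) else greedySet r

variable {G}

theorem mem_of_mem_greedySet {r : List V} {v : V} (h : v ∈ greedySet G r) : v ∈ r := by
  induction r with
  | nil => simp [greedySet] at h
  | cons x r ih =>
    by_cases hx : Survives G r x
    · rw [greedySet, if_pos hx, Finset.mem_insert] at h
      rcases h with rfl | h
      · simp
      · exact List.mem_cons_of_mem _ (ih h)
    · rw [greedySet, if_neg hx] at h
      exact List.mem_cons_of_mem _ (ih h)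

theorem survives_iff {r : List V} {v : V} :
    Survives G r v ↔ ∀ x ∈ greedySet G r, ¬ G.Adj v x := by
  induction r with
  | nil => simp [Survives, greedySet]
  | cons x r ih =>
    by_cases hx : Survives G r x
    · rw [greedySet, if_pos hx, Finset.forall_mem_insert, ← ih]
      simp only [Survives, hx, and_true]
      exact and_comm
    · simp [Survives, greedySet, hx, ih]

theorem isIndepSet_greedySet (r : List V) : G.IsIndepSet (greedySet G r : Set V) := by
  induction r with
  | nil => simp [greedySet, SimpleGraph.IsIndepSet]
  | cons x r ih =>
    by_cases hx : Survives G r x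
    · rw [greedySet, if_pos hx, Finset.coe_insert]
      refine Set.pairwise_insert.2 ⟨ih, fun u hu _ => ?_⟩
      have := survives_iff.1 hx u hu
      exact ⟨this, fun h => this h.symm⟩
    · rwa [greedySet, if_neg hx]

theorem mem_greedySet_or_exists_adj {r : List V} {v : V} (hv : v ∈ r) :
    v ∈ greedySet G r ∨ ∃ x ∈ greedySet G r, G.Adj v x := by
  induction r with
  | nil => simp at hv
  | cons x r ih =>
    have hsub : greedySet G r ⊆ greedySet G (x :: r) := by
      rw [greedySet]
      split_ifs
      exacts [Finset.subset_insert _ _, subset_rfl]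
    by_cases hvr : v ∈ r
    · rcases ih hvr with h | ⟨y, hy, h⟩
      exacts [Or.inl (hsub h), Or.inr ⟨y, hsub hy, h⟩]
    · obtain rfl : v = x := by simpa [hvr] using hv
      by_cases hx : Survives G r v
      · left
        rw [greedySet, if_pos hx]
        exact Finset.mem_insert_self _ _
      · rw [survives_iff] at hx
        push Not at hx
        obtain ⟨y, hy, h⟩ := hx
        exact Or.inr ⟨y, hsub hy, h⟩

theorem isMIS_greedySet {r : List V} (hr : ∀ v, v ∈ r) : IsMIS G (greedySet G r) := by
  refine ⟨isIndepSet_greedySet r, fun S hS _ v hv => ?_⟩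
  rename_i hle
  rcases mem_greedySet_or_exists_adj (G := G) (hr v) with h | ⟨x, hx, hadj⟩
  · exact h
  · exact absurd hadj (hS (Finset.mem_coe.2 hv) (Finset.mem_coe.2 (hle hx)) hadj.ne)

/-- The elements of `l` before `v` in reverse order, followed by `r`. -/
noncomputable def before : List V → List V → V → List V
  | r, [], _ => r
  | r, x :: l, v => if x = v then r else before (x :: r) l v

theorem mem_greedySet_reverseAux_of_notMem {r l : List V} {v : V} (hv : v ∉ l) :
    v ∈ greedySet G (l.reverseAux r) ↔ v ∈ greedySet G r := by
  induction l generalizing r with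
  | nil => rfl
  | cons x l ih =>
    rw [List.mem_cons, not_or] at hv
    rw [List.reverseAux, ih hv.2, greedySet]
    split_ifs <;> simp [hv.1]

theorem mem_greedySet_reverseAux {r l : List V} {v : V} (hl : l.Nodup) (hv : v ∈ l)
    (hvr : v ∉ r) : v ∈ greedySet G (l.reverseAux r) ↔ Survives G (before r l v) v := by
  induction l generalizing r with
  | nil => simp at hv
  | cons x l ih =>
    rw [List.nodup_cons] at hl
    by_cases hx : x = v
    · subst hx
      rw [List.reverseAux, mem_greedySet_reverseAux_of_notMem hl.1, before, if_pos rfl, greedySet]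
      split_ifs with h
      · simp [h]
      · simp only [h, iff_false]
        exact fun h' => hvr (mem_of_mem_greedySet h')
    · have hvl : v ∈ l := by
        rcases List.mem_cons.1 hv with h | h
        exacts [absurd h.symm hx, h]
      rw [List.reverseAux, before, if_neg hx]
      exact ih hl.2 hvl (by simp [hvr, Ne.symm hx])

variable (G)

/-- The number of queries of the recursive test whether `v` survives the greedy independent set of
`r`: the vertices of `r` are examined in the order of processing until a neighbour in the
set is found; adjacent ones are tested recursively. -/
noncomputable def testCost : List V → V → ℕ
  | [], _ => 0
  | x :: r, v => testCost r v +
      if Survives G r v then 1 + (if G.Adj v x then testCost r x else 0) else 0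

/-- The total cost of the tests for all vertices of `l`, when `r` has been processed before. -/
noncomputable def totalCost : List V → List V → ℕ
  | _, [] => 0
  | r, x :: l => testCost G r x + totalCost (x :: r) l

theorem sum_testCost_before {r l : List V} (hl : l.Nodup) :
    ∑ v ∈ l.toFinset, testCost G (before r l v) v = totalCost G r l := by
  induction l generalizing r with
  | nil => simp [totalCost]
  | cons x l ih =>
    rw [List.nodup_cons] at hl
    rw [List.toFinset_cons, Finset.sum_insert (by simpa using hl.1), totalCost, ← ih hl.2]
    congr 1
    · simp [before]
    · refine Finset.sum_congr rfl fun v hv => ?_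
      have : x ≠ v := by
        rintro rfl
        exact hl.1 (List.mem_toFinset.1 hv)
      rw [before, if_neg this]

/-- The neighbours of `u` in `S` that survive `r`. -/
noncomputable def survivingNeighbors (r : List V) (S : Finset V) (u : V) : Finset V :=
  S.filter fun v => G.Adj v u ∧ Survives G r v

variable {G} in
theorem mem_survivingNeighbors {r : List V} {S : Finset V} {u v : V} :
    v ∈ survivingNeighbors G r S u ↔ v ∈ S ∧ G.Adj v u ∧ Survives G r v :=
  Finset.mem_filter

variable [Fintype V]

/-- The number of times `u` is tested, if the test is started once from every vertex of `l`, and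
the vertices `l` are processed after `r`. Only the part of the recursion inside `l` counts. -/
noncomputable def calls : List V → List V → V → ℕ
  | _, [], _ => 0
  | r, x :: l, u =>
      (if x = u then 1 + ∑ v, if G.Adj v x ∧ Survives G r v then calls (x :: r) l v else 0 else 0)
        + calls (x :: r) l u

/-- The number of queries between two vertices of `l` in all the tests counted by `calls`. -/
noncomputable def innerQueries : List V → List V → ℕ
  | _, [] => 0
  | r, x :: l => (∑ v, if Survives G r v then calls G (x :: r) l v else 0) +
      innerQueries (x :: r) l

/-- The queries are sorted by the earlier of the two vertices. -/
theorem totalCost_eq (r l : List V) :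
    totalCost G r l = ∑ v, calls G r l v * testCost G r v + innerQueries G r l := by
  induction l generalizing r with
  | nil => simp [totalCost, calls, innerQueries]
  | cons x l ih =>
    rw [totalCost, ih, innerQueries]
    have h1 : ∑ v, calls G r (x :: l) v * testCost G r v =
        (1 + ∑ v, if G.Adj v x ∧ Survives G r v then calls G (x :: r) l v else 0)
          * testCost G r x + ∑ v, calls G (x :: r) l v * testCost G r v := by
      simp only [calls, add_mul, Finset.sum_add_distrib, ite_mul, zero_mul, Finset.sum_ite_eq,
        Finset.mem_univ, if_true]
    have h2 : ∑ v, calls G (x :: r) l v * testCost G (x :: r) v =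
        ∑ v, calls G (x :: r) l v * testCost G r v
        + (∑ v, if Survives G r v then calls G (x :: r) l v else 0)
        + (∑ v, if G.Adj v x ∧ Survives G r v then calls G (x :: r) l v else 0)
          * testCost G r x := by
      rw [Finset.sum_mul, ← Finset.sum_add_distrib, ← Finset.sum_add_distrib]
      refine Finset.sum_congr rfl fun v _ => ?_
      rw [testCost]
      by_cases hs : Survives G r v <;> by_cases ha : G.Adj v x <;> simp [hs, ha] <;> ring
    rw [h1, h2]
    ring

/-- The bound for the expected number of calls of `u` when the vertices `S` remain. -/
noncomputable def callBound (r : List V) (S : Finset V) (u : V) : ℕ :=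
  if u ∈ S then 1 + (survivingNeighbors G r S u).card else 0

theorem callBound_step (r : List V) (S : Finset V) (u : V) :
    ∑ x ∈ S, ((if x = u then 1 + ∑ v, if G.Adj v x ∧ Survives G r v then
        callBound G (x :: r) (S.erase x) v else 0 else 0) + callBound G (x :: r) (S.erase x) u)
      ≤ S.card * callBound G r S u := by
  by_cases hu : u ∈ S
  swap
  · refine le_of_eq_of_le (Finset.sum_eq_zero fun x hx => ?_) (Nat.zero_le _)
    have : x ≠ u := by
      rintro rfl
      exact hu hx
    simp [this, callBound, hu]
  set A := survivingNeighbors G r S u with hA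
  -- a vertex `x` placed first either removes `v` from the surviving neighbours of `u` or is not
  -- itself a surviving neighbour of `v`
  have key : ∀ v ∈ A, 1 + (survivingNeighbors G (u :: r) (S.erase u) v).card +
      ((S.erase u).filter fun x => v ≠ x ∧ ¬ (G.Adj v x ∧ Survives G r x)).card ≤ S.card := by
    intro v _
    have hdisj : Disjoint (survivingNeighbors G (u :: r) (S.erase u) v)
        ((S.erase u).filter fun x => v ≠ x ∧ ¬ (G.Adj v x ∧ Survives G r x)) := by
      rw [Finset.disjoint_left]
      intro x hx hx'
      have h1 := (mem_survivingNeighbors.1 hx).2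
      exact (Finset.mem_filter.1 hx').2.2 ⟨h1.1.symm, h1.2.1⟩
    have hsub : survivingNeighbors G (u :: r) (S.erase u) v ⊆ S.erase u :=
      Finset.filter_subset _ _
    have := Finset.card_le_card (Finset.union_subset hsub
      (Finset.filter_subset (fun x => v ≠ x ∧ ¬ (G.Adj v x ∧ Survives G r x)) (S.erase u)))
    rw [Finset.card_union_of_disjoint hdisj, Finset.card_erase_of_mem hu] at this
    have hpos := Finset.card_pos.2 ⟨u, hu⟩
    omega
  have h1 : (∑ v, if G.Adj v u ∧ Survives G r v then
      callBound G (u :: r) (S.erase u) v else 0) ≤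
      ∑ v ∈ A, (1 + (survivingNeighbors G (u :: r) (S.erase u) v).card) := by
    rw [hA, survivingNeighbors, Finset.sum_filter, ← Finset.sum_subset (Finset.subset_univ S)]
    · refine Finset.sum_le_sum fun v _ => ?_
      split_ifs
      · rw [callBound]
        split_ifs <;> omega
      · exact le_rfl
    · intro v _ hv
      simp [callBound, hv]
  have h2 : ∀ x ∈ S.erase u, callBound G (x :: r) (S.erase x) u ≤
      1 + ∑ v ∈ A, if v ≠ x ∧ ¬ (G.Adj v x ∧ Survives G r x) then 1 else 0 := by
    intro x hx
    rw [callBound, ← Finset.card_filter]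
    split_ifs
    · refine Nat.add_le_add_left (Finset.card_le_card fun v hv => ?_) 1
      rw [mem_survivingNeighbors, Finset.mem_erase] at hv
      exact Finset.mem_filter.2 ⟨mem_survivingNeighbors.2 ⟨hv.1.2, hv.2.1, hv.2.2.1⟩,
        hv.1.1, hv.2.2.2⟩
    · omega
  calc _ = (1 + ∑ v, if G.Adj v u ∧ Survives G r v then
        callBound G (u :: r) (S.erase u) v else 0) +
        ∑ x ∈ S.erase u, callBound G (x :: r) (S.erase x) u := by
        rw [Finset.sum_add_distrib, Finset.sum_ite_eq' S u, if_pos hu,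
          ← Finset.add_sum_erase S _ hu]
        have : callBound G (u :: r) (S.erase u) u = 0 := by simp [callBound]
        rw [this, zero_add]
    _ ≤ (1 + ∑ v ∈ A, (1 + (survivingNeighbors G (u :: r) (S.erase u) v).card)) +
        ∑ x ∈ S.erase u, (1 + ∑ v ∈ A, if v ≠ x ∧ ¬ (G.Adj v x ∧ Survives G r x) then 1 else 0) :=
        Nat.add_le_add (Nat.add_le_add_left h1 1) (Finset.sum_le_sum h2)
    _ = S.card + ∑ v ∈ A, (1 + (survivingNeighbors G (u :: r) (S.erase u) v).card +
        ((S.erase u).filter fun x => v ≠ x ∧ ¬ (G.Adj v x ∧ Survives G r x)).card) := by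
        rw [Finset.sum_add_distrib (s := S.erase u), Finset.sum_comm (s := S.erase u),
          Finset.sum_add_distrib (s := A) (g := fun v => Finset.card (Finset.filter _ _))]
        simp only [Finset.card_filter, Finset.sum_const, Finset.card_erase_of_mem hu, smul_eq_mul,
          mul_one]
        have hpos := Finset.card_pos.2 ⟨u, hu⟩
        omega
    _ ≤ S.card + ∑ v ∈ A, S.card := Nat.add_le_add_left (Finset.sum_le_sum key) _
    _ = S.card * callBound G r S u := by
        rw [callBound, if_pos hu, Finset.sum_const, smul_eq_mul]
        ring

/-- The number of vertices of `S` that survive `r`. -/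
noncomputable def numSurviving (r : List V) (S : Finset V) : ℕ := (S.filter (Survives G r)).card

theorem numSurviving_step (r : List V) (S : Finset V) :
    ∑ x ∈ S, ((∑ v, if Survives G r v then callBound G (x :: r) (S.erase x) v else 0) +
        (S.card - 1) * numSurviving G (x :: r) (S.erase x))
      ≤ S.card * (S.card * numSurviving G r S) := by
  set A := S.filter (Survives G r) with hA
  have h1 : ∀ x ∈ S, (∑ v, if Survives G r v then callBound G (x :: r) (S.erase x) v else 0) ≤
      ∑ v ∈ A, if x ≠ v then 1 + (survivingNeighbors G r S v).card else 0 := by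
    intro x hx
    rw [hA, Finset.sum_filter, ← Finset.sum_subset (Finset.subset_univ S)]
    · refine Finset.sum_le_sum fun v _ => ?_
      split_ifs with hs hxv
      · rw [callBound]
        split_ifs
        · refine Nat.add_le_add_left (Finset.card_le_card fun y hy => ?_) 1
          rw [mem_survivingNeighbors, Finset.mem_erase] at hy
          exact mem_survivingNeighbors.2 ⟨hy.1.2, hy.2.1, hy.2.2.1⟩
        · omega
      · obtain rfl : x = v := by simpa using hxv
        simp [callBound]
      · exact le_rfl
    · intro v _ hv
      simp [callBound, hv]
  have h2 : ∀ x ∈ S, numSurviving G (x :: r) (S.erase x) ≤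
      ∑ v ∈ A, if x ≠ v ∧ ¬ (G.Adj v x ∧ Survives G r x) then 1 else 0 := by
    intro x hx
    rw [numSurviving, ← Finset.card_filter]
    refine Finset.card_le_card fun v hv => ?_
    obtain ⟨h1, h2⟩ := Finset.mem_filter.1 hv
    rw [Finset.mem_erase] at h1
    exact Finset.mem_filter.2 ⟨Finset.mem_filter.2 ⟨h1.2, h2.1⟩, h1.1.symm, h2.2⟩
  have key : ∀ v ∈ A, (1 + (survivingNeighbors G r S v).card) +
      (S.filter fun x => x ≠ v ∧ ¬ (G.Adj v x ∧ Survives G r x)).card ≤ S.card := by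
    intro v hv
    have hvS : v ∈ S := (Finset.mem_filter.1 hv).1
    have hdisj : Disjoint (survivingNeighbors G r S v)
        (S.filter fun x => x ≠ v ∧ ¬ (G.Adj v x ∧ Survives G r x)) := by
      rw [Finset.disjoint_left]
      intro x hx hx'
      simp only [survivingNeighbors, Finset.mem_filter] at hx hx'
      exact hx'.2.2 ⟨hx.2.1.symm, hx.2.2⟩
    have hsub : survivingNeighbors G r S v ∪
        (S.filter fun x => x ≠ v ∧ ¬ (G.Adj v x ∧ Survives G r x)) ⊆ S.erase v := by
      intro x hx
      simp only [survivingNeighbors, Finset.mem_union, Finset.mem_filter, Finset.mem_erase] at hx ⊢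
      rcases hx with h | h
      exacts [⟨h.2.1.ne, h.1⟩, ⟨h.2.1, h.1⟩]
    have := Finset.card_le_card hsub
    rw [Finset.card_union_of_disjoint hdisj, Finset.card_erase_of_mem hvS] at this
    have hpos := Finset.card_pos.2 ⟨v, hvS⟩
    omega
  calc _ ≤ ∑ x ∈ S, ((∑ v ∈ A, if x ≠ v then 1 + (survivingNeighbors G r S v).card else 0) +
        (S.card - 1) * ∑ v ∈ A, if x ≠ v ∧ ¬ (G.Adj v x ∧ Survives G r x) then 1 else 0) :=
        Finset.sum_le_sum fun x hx =>
          Nat.add_le_add (h1 x hx) (Nat.mul_le_mul_left _ (h2 x hx))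
    _ = ∑ v ∈ A, (S.card - 1) * ((1 + (survivingNeighbors G r S v).card) +
      (S.filter fun x => x ≠ v ∧ ¬ (G.Adj v x ∧ Survives G r x)).card) := by
        rw [Finset.sum_add_distrib, ← Finset.mul_sum, Finset.sum_comm (s := S),
          Finset.sum_comm (s := S), Finset.mul_sum, ← Finset.sum_add_distrib]
        refine Finset.sum_congr rfl fun v hv => ?_
        have hvS : v ∈ S := (Finset.mem_filter.1 hv).1
        rw [mul_add, Finset.card_filter, ← Finset.sum_filter, Finset.sum_const, smul_eq_mul,
          Finset.filter_ne', Finset.card_erase_of_mem hvS]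
    _ ≤ ∑ v ∈ A, S.card * S.card := Finset.sum_le_sum fun v hv =>
        Nat.mul_le_mul (Nat.sub_le _ _) (key v hv)
    _ = S.card * (S.card * numSurviving G r S) := by
        rw [Finset.sum_const, smul_eq_mul, numSurviving]
        ring

end Greedy

/-! ### The expected cost in a random order -/

section RandomOrder

open Classical

variable {V : Type}

/-- A uniformly random order of the `N` elements of `S`. -/
noncomputable def randOrder : ℕ → Finset V → PMF (List V)
  | 0, _ => PMF.pure []
  | N + 1, S => if h : S.Nonempty then
      (PMF.uniformOfFinset S h).bind fun x => (randOrder N (S.erase x)).map (x :: ·)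
    else PMF.pure []

theorem expect_randOrder_succ {N : ℕ} {S : Finset V} (hS : S.card = N + 1)
    (f : List V → ℝ≥0∞) : expect (randOrder (N + 1) S) f =
      (∑ x ∈ S, expect (randOrder N (S.erase x)) fun l => f (x :: l)) / S.card := by
  have h : S.Nonempty := Finset.card_pos.1 (by omega)
  rw [randOrder, dif_pos h, expect_bind, expect_uniformOfFinset]
  simp_rw [expect_map]

theorem mem_support_randOrder {N : ℕ} {S : Finset V} (hS : S.card = N) {l : List V}
    (hl : l ∈ (randOrder N S).support) : l.Nodup ∧ ∀ v, v ∈ l ↔ v ∈ S := by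
  induction N generalizing S l with
  | zero =>
    rw [randOrder, PMF.mem_support_pure_iff] at hl
    subst hl
    rw [Finset.card_eq_zero] at hS
    simp [hS]
  | succ N ih =>
    have h : S.Nonempty := Finset.card_pos.1 (by omega)
    rw [randOrder, dif_pos h, PMF.mem_support_bind_iff] at hl
    obtain ⟨x, hx, hl⟩ := hl
    rw [PMF.mem_support_uniformOfFinset_iff] at hx
    rw [PMF.mem_support_map_iff] at hl
    obtain ⟨l', hl', rfl⟩ := hl
    obtain ⟨h1, h2⟩ := ih (by rw [Finset.card_erase_of_mem hx]; omega) hl'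
    refine ⟨List.nodup_cons.2 ⟨by simp [h2], h1⟩, fun v => ?_⟩
    rw [List.mem_cons, h2, Finset.mem_erase]
    by_cases hvx : v = x <;> simp [hvx, hx]

variable [Fintype V] (G : SimpleGraph V)

/-- In a random order of `S`, the expected number of calls of a vertex is at most one plus the
number of its surviving neighbours. -/
theorem expect_calls_le {N : ℕ} {S : Finset V} (hS : S.card = N) (r : List V) (u : V) :
    expect (randOrder N S) (fun l => (calls G r l u : ℝ≥0∞)) ≤ (callBound G r S u : ℝ≥0∞) := by
  induction N generalizing S r u with
  | zero => simp [randOrder, expect_pure, calls]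
  | succ N ih =>
    rw [expect_randOrder_succ hS]
    refine ENNReal.div_le_of_le_mul ?_
    calc _ ≤ ∑ x ∈ S, (((if x = u then 1 + ∑ v, if G.Adj v x ∧ Survives G r v then
        callBound G (x :: r) (S.erase x) v else 0 else 0) +
        callBound G (x :: r) (S.erase x) u : ℕ) : ℝ≥0∞) := by
          refine Finset.sum_le_sum fun x hx => ?_
          have hcard : (S.erase x).card = N := by rw [Finset.card_erase_of_mem hx]; omega
          simp only [calls, Nat.cast_add, expect_add]
          refine add_le_add ?_ (ih hcard _ _)
          split_ifs with hxu
          · simp only [Nat.cast_add, Nat.cast_one, expect_add, expect_const, Nat.cast_sum,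
              expect_sum]
            refine add_le_add_right (Finset.sum_le_sum fun v _ => ?_) _
            split_ifs
            · exact ih hcard _ _
            · simp [expect_const]
          · simp [expect_const]
      _ ≤ ((S.card * callBound G r S u : ℕ) : ℝ≥0∞) := by
          rw [← Nat.cast_sum]
          exact Nat.cast_le.2 (callBound_step G r S u)
      _ = _ := by push_cast; ring

theorem expect_innerQueries_le {N : ℕ} {S : Finset V} (hS : S.card = N) (r : List V) :
    expect (randOrder N S) (fun l => (innerQueries G r l : ℝ≥0∞)) ≤
      ((S.card * numSurviving G r S : ℕ) : ℝ≥0∞) := by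
  induction N generalizing S r with
  | zero => simp [randOrder, expect_pure, innerQueries]
  | succ N ih =>
    rw [expect_randOrder_succ hS]
    refine ENNReal.div_le_of_le_mul ?_
    calc _ ≤ ∑ x ∈ S, (((∑ v, if Survives G r v then callBound G (x :: r) (S.erase x) v else 0) +
        (S.card - 1) * numSurviving G (x :: r) (S.erase x) : ℕ) : ℝ≥0∞) := by
          refine Finset.sum_le_sum fun x hx => ?_
          have hcard : (S.erase x).card = N := by rw [Finset.card_erase_of_mem hx]; omega
          have h := ih hcard (x :: r)
          rw [Finset.card_erase_of_mem hx] at h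
          rw [Nat.cast_add]
          simp only [innerQueries, Nat.cast_add, expect_add]
          refine add_le_add ?_ h
          simp only [Nat.cast_sum, expect_sum]
          refine Finset.sum_le_sum fun v _ => ?_
          split_ifs
          · exact expect_calls_le G hcard _ _
          · simp [expect_const]
      _ ≤ ((S.card * (S.card * numSurviving G r S) : ℕ) : ℝ≥0∞) := by
          rw [← Nat.cast_sum]
          exact Nat.cast_le.2 (numSurviving_step G r S)
      _ = _ := by push_cast; ring

/-- In a random order, the tests of all vertices make at most `n²` queries in expectation. -/
theorem expect_sum_testCost_le :
    expect (randOrder (Fintype.card V) (Finset.univ : Finset V))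
      (fun l => ((∑ v, testCost G (before [] l v) v : ℕ) : ℝ≥0∞)) ≤
      ((Fintype.card V * Fintype.card V : ℕ) : ℝ≥0∞) := by
  have hcard : (Finset.univ : Finset V).card = Fintype.card V := Finset.card_univ
  calc _ ≤ expect (randOrder (Fintype.card V) (Finset.univ : Finset V))
        (fun l => (innerQueries G [] l : ℝ≥0∞)) := by
        refine expect_mono _ fun l hl => ?_
        obtain ⟨h1, h2⟩ := mem_support_randOrder hcard hl
        have huniv : l.toFinset = Finset.univ := by
          ext v
          simp [h2]
        rw [← huniv, sum_testCost_before G h1, totalCost_eq]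
        simp [testCost]
    _ ≤ _ := expect_innerQueries_le G hcard []
    _ ≤ _ := by
        rw [hcard]
        refine Nat.cast_le.2 (Nat.mul_le_mul_left _ ?_)
        rw [← hcard]
        exact Finset.card_filter_le _ _

end RandomOrder

/-! ### Query algorithms for the greedy set -/

section TreeAlgorithms

open Classical

variable {V : Type}

/-- The recursive test whether `v` survives the greedy independent set of a list. -/
def testAlg : List V → V → QueryAlg V Bool Bool
  | [], _ => .done true
  | x :: r, v => (testAlg r v).bind fun b =>
      if b then .query v x fun a =>
        if a then (testAlg r x).bind fun b' => .done (!b') else .done true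
      else .done false

theorem eval_testAlg (G : SimpleGraph V) (r : List V) (v : V) :
    (testAlg r v).eval (adjOracle G) = decide (Survives G r v) := by
  induction r generalizing v with
  | nil => exact (decide_eq_true (p := Survives G [] v) trivial).symm
  | cons x r ih =>
    rw [testAlg, QueryAlg.eval_bind, ih]
    by_cases hs : Survives G r v <;> by_cases ha : G.Adj v x <;>
      simp [hs, ha, QueryAlg.eval, QueryAlg.eval_bind, Survives, adjOracle, ih]

theorem queries_testAlg (G : SimpleGraph V) (r : List V) (v : V) :
    (testAlg r v).queries (adjOracle G) = testCost G r v := by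
  induction r generalizing v with
  | nil => simp [testAlg, QueryAlg.queries, testCost]
  | cons x r ih =>
    rw [testAlg, QueryAlg.queries_bind, ih, eval_testAlg, testCost]
    by_cases hs : Survives G r v <;> by_cases ha : G.Adj v x <;>
      simp [hs, ha, QueryAlg.queries, QueryAlg.queries_bind, adjOracle, ih]
    omega

/-- Count the members of the greedy independent set of `l` in a list of samples. -/
noncomputable def countAlg (l : List V) : List V → QueryAlg V Bool ℕ
  | [] => .done 0
  | v :: vs => (testAlg (before [] l v) v).bind fun b =>
      (countAlg l vs).bind fun m => .done ((if b then 1 else 0) + m)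

theorem eval_countAlg (G : SimpleGraph V) (l vs : List V) :
    (countAlg l vs).eval (adjOracle G) =
      (vs.map fun v => if Survives G (before [] l v) v then 1 else 0).sum := by
  induction vs with
  | nil => simp [countAlg, QueryAlg.eval]
  | cons v vs ih => simp [countAlg, QueryAlg.eval_bind, QueryAlg.eval, ih, eval_testAlg]

theorem queries_countAlg (G : SimpleGraph V) (l vs : List V) :
    (countAlg l vs).queries (adjOracle G) =
      (vs.map fun v => testCost G (before [] l v) v).sum := by
  induction vs with
  | nil => simp [countAlg, QueryAlg.queries]
  | cons v vs ih => simp [countAlg, QueryAlg.queries_bind, QueryAlg.queries, ih, queries_testAlg]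

/-- Test whether `x` has no neighbour in a list. -/
def isolatedAlg (x : V) : List V → QueryAlg V Bool Bool
  | [] => .done true
  | y :: J => .query x y fun a => if a then .done false else isolatedAlg x J

theorem eval_isolatedAlg (G : SimpleGraph V) (x : V) (J : List V) :
    (isolatedAlg x J).eval (adjOracle G) = decide (∀ y ∈ J, ¬ G.Adj x y) := by
  induction J with
  | nil => simp [isolatedAlg, QueryAlg.eval]
  | cons y J ih => by_cases h : G.Adj x y <;> simp [isolatedAlg, QueryAlg.eval, adjOracle, h, ih]

theorem queries_isolatedAlg_le (G : SimpleGraph V) (x : V) (J : List V) :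
    (isolatedAlg x J).queries (adjOracle G) ≤ J.length := by
  induction J with
  | nil => simp [isolatedAlg, QueryAlg.queries]
  | cons y J ih =>
    by_cases h : G.Adj x y <;> simp [isolatedAlg, QueryAlg.queries, adjOracle, h, ih]

/-- Extend the independent set `J` greedily along a list and return its final size, unless there
are vertices left when the size reaches `t`. -/
def scanAlg (t : ℕ) : List V → List V → QueryAlg V Bool (Option ℕ)
  | [], J => .done (some J.length)
  | x :: l, J => if t ≤ J.length then .done none else
      (isolatedAlg x J).bind fun b => scanAlg t l (if b then x :: J else J)

theorem queries_scanAlg_le (G : SimpleGraph V) (t : ℕ) (l J : List V) :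
    (scanAlg t l J).queries (adjOracle G) ≤ t * l.length := by
  induction l generalizing J with
  | nil => simp [scanAlg, QueryAlg.queries]
  | cons x l ih =>
    rw [scanAlg]
    split_ifs with h
    · simp [QueryAlg.queries]
    · rw [QueryAlg.queries_bind, List.length_cons, mul_add, mul_one, add_comm]
      exact Nat.add_le_add (ih _) ((queries_isolatedAlg_le G x J).trans (not_le.1 h).le)

theorem greedySet_subset_reverseAux (G : SimpleGraph V) (r l : List V) :
    greedySet G r ⊆ greedySet G (l.reverseAux r) := by
  induction l generalizing r with
  | nil => exact subset_rfl
  | cons x l ih =>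
    refine Finset.Subset.trans ?_ (ih (x :: r))
    rw [greedySet]
    split_ifs
    exacts [Finset.subset_insert _ _, subset_rfl]

theorem eval_scanAlg (G : SimpleGraph V) (t : ℕ) {l r J : List V} (hl : l.Nodup)
    (hlr : ∀ v ∈ l, v ∉ r) (hJ : ∀ v, v ∈ J ↔ v ∈ greedySet G r)
    (hcard : J.length = (greedySet G r).card) :
    (scanAlg t l J).eval (adjOracle G) = some (greedySet G (l.reverseAux r)).card ∨
      ((scanAlg t l J).eval (adjOracle G) = none ∧
        t ≤ (greedySet G (l.reverseAux r)).card) := by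
  induction l generalizing r J with
  | nil => left; simp [scanAlg, QueryAlg.eval, hcard]
  | cons x l ih =>
    rw [List.nodup_cons] at hl
    rw [scanAlg]
    split_ifs with h
    · right
      refine ⟨rfl, ?_⟩
      rw [hcard] at h
      exact h.trans (Finset.card_le_card (greedySet_subset_reverseAux G r _))
    · rw [QueryAlg.eval_bind, eval_isolatedAlg, List.reverseAux]
      have hs : (∀ y ∈ J, ¬ G.Adj x y) ↔ Survives G r x := by
        rw [survives_iff]
        exact forall_congr' fun y => by rw [hJ]
      have hxr : x ∉ greedySet G r := fun hx => hlr x (by simp) (mem_of_mem_greedySet hx)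
      have hlr' : ∀ v ∈ l, v ∉ x :: r := by
        intro v hv
        rw [List.mem_cons, not_or]
        refine ⟨?_, hlr v (List.mem_cons_of_mem _ hv)⟩
        rintro rfl
        exact hl.1 hv
      by_cases hx : Survives G r x
      · simp only [hs, hx, decide_true, if_true]
        refine ih hl.2 hlr' ?_ ?_
        · intro v
          rw [greedySet, if_pos hx, List.mem_cons, Finset.mem_insert, hJ]
        · rw [greedySet, if_pos hx, Finset.card_insert_of_notMem hxr, List.length_cons, hcard]
      · simp only [hs, hx, decide_false, Bool.false_eq_true, if_false]
        refine ih hl.2 hlr' ?_ ?_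
        · intro v
          rw [greedySet, if_neg hx, hJ]
        · rw [greedySet, if_neg hx, hcard]

end TreeAlgorithms

/-! ### Chernoff bound for random samples -/

section Sampling

open Classical

variable {V : Type} [Fintype V] [Nonempty V]

/-- A list of `s` independent uniformly random vertices. -/
noncomputable def samples (V : Type) [Fintype V] [Nonempty V] : ℕ → PMF (List V)
  | 0 => PMF.pure []
  | s + 1 => (PMF.uniformOfFinset Finset.univ Finset.univ_nonempty).bind fun v =>
      (samples V s).map (v :: ·)

theorem expect_samples_sum (s : ℕ) (f : V → ℝ≥0∞) :
    expect (samples V s) (fun vs => (vs.map f).sum) = s * ((∑ v, f v) / Fintype.card V) := by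
  induction s with
  | zero => simp [samples, expect_pure]
  | succ s ih =>
    simp only [samples, expect_bind, expect_map, List.map_cons, List.sum_cons, expect_add,
      expect_const, ih]
    rw [expect_uniformOfFinset, Finset.card_univ]
    push_cast
    ring

theorem expect_samples_prod (s : ℕ) (f : V → ℝ≥0∞) :
    expect (samples V s) (fun vs => (vs.map f).prod) = ((∑ v, f v) / Fintype.card V) ^ s := by
  induction s with
  | zero => simp [samples, expect_pure]
  | succ s ih =>
    simp only [samples, expect_bind, expect_map, List.map_cons, List.prod_cons, expect_const_mul,
      ih]
    rw [expect_uniformOfFinset, Finset.card_univ, ← Finset.sum_mul, pow_succ']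
    simp only [div_eq_mul_inv]
    ring

/-- The number of entries of a list that lie in `I`. -/
noncomputable def hits (I : Finset V) (vs : List V) : ℕ :=
  (vs.map fun v => if v ∈ I then 1 else 0).sum

/-- Exponential Markov inequality for the number of samples in a set; `θ > 0` gives the upper tail
and `θ < 0` the lower tail. -/
theorem samples_tail_le (I : Finset V) (s : ℕ) {θ : ℝ} (hθ : |θ| ≤ 1) (a : ℝ) :
    expect (samples V s) (fun vs =>
        if θ * a ≤ θ * hits I vs then 1 else 0) ≤
      ENNReal.ofReal (Real.exp (s * (I.card / Fintype.card V * (θ + θ ^ 2)) - θ * a)) := by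
  have hn : (0 : ℝ) < Fintype.card V := by exact_mod_cast Fintype.card_pos
  set f : V → ℝ≥0∞ := fun v => ENNReal.ofReal (Real.exp (θ * if v ∈ I then 1 else 0)) with hf
  have hprod : ∀ vs : List V, (vs.map f).prod =
      ENNReal.ofReal (Real.exp (θ * hits I vs)) := by
    intro vs
    induction vs with
    | nil => simp [hits]
    | cons v vs ih =>
      rw [List.map_cons, List.prod_cons, ih, hits, hits, List.map_cons, List.sum_cons,
        Nat.cast_add, mul_add, Real.exp_add, ENNReal.ofReal_mul (Real.exp_pos _).le, hf]
      push_cast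
      rfl
  have hmean : (∑ v, f v) / Fintype.card V ≤
      ENNReal.ofReal (Real.exp (I.card / Fintype.card V * (θ + θ ^ 2))) := by
    have hsum : ∑ v, f v =
        ENNReal.ofReal (I.card * Real.exp θ + (Fintype.card V - I.card)) := by
      rw [hf, ← ENNReal.ofReal_sum_of_nonneg fun v _ => (Real.exp_pos _).le]
      congr 1
      have : ∀ v : V, Real.exp (θ * if v ∈ I then 1 else 0) =
          (if v ∈ I then Real.exp θ - 1 else 0) + 1 := by
        intro v
        split_ifs <;> simp
      simp only [this, Finset.sum_add_distrib, Finset.sum_ite_mem, Finset.univ_inter,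
        Finset.sum_const, nsmul_eq_mul, Finset.card_univ]
      ring
    have hcast : (Fintype.card V : ℝ≥0∞) = ENNReal.ofReal (Fintype.card V : ℝ) := by
      rw [ENNReal.ofReal_natCast]
    rw [hsum, hcast, ← ENNReal.ofReal_div_of_pos hn]
    refine ENNReal.ofReal_le_ofReal ?_
    have h1 : Real.exp θ ≤ 1 + (θ + θ ^ 2) := by
      have := (abs_le.1 (Real.abs_exp_sub_one_sub_id_le hθ)).2
      linarith
    have h2 := Real.add_one_le_exp ((I.card : ℝ) / Fintype.card V * (θ + θ ^ 2))
    refine le_trans ?_ h2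
    rw [div_le_iff₀ hn, add_mul, mul_right_comm, div_mul_cancel₀ _ hn.ne']
    have : (0 : ℝ) ≤ I.card := by positivity
    nlinarith
  have hmarkov := expect_indicator_le_div (samples V s) (fun vs => (vs.map f).prod)
    (t := ENNReal.ofReal (Real.exp (θ * a))) (by simp [Real.exp_pos]) ENNReal.ofReal_ne_top
  calc _ ≤ expect (samples V s) (fun vs =>
        if ENNReal.ofReal (Real.exp (θ * a)) ≤ (vs.map f).prod then 1 else 0) := by
        refine expect_mono _ fun vs _ => ?_
        split_ifs with h h'
        · exact le_rfl
        · refine absurd ?_ h'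
          rw [hprod]
          exact ENNReal.ofReal_le_ofReal (Real.exp_le_exp.2 h)
        all_goals exact zero_le
    _ ≤ _ := hmarkov
    _ ≤ ENNReal.ofReal (Real.exp (I.card / Fintype.card V * (θ + θ ^ 2))) ^ s /
        ENNReal.ofReal (Real.exp (θ * a)) := by
        rw [expect_samples_prod]
        gcongr
    _ = _ := by
        rw [← ENNReal.ofReal_pow (Real.exp_pos _).le, ← ENNReal.ofReal_div_of_pos (Real.exp_pos _),
          ← Real.exp_nat_mul, ← Real.exp_sub]

/-- Multiplicative Chernoff bound for the number of samples in a set. -/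
theorem samples_chernoff (I : Finset V) (s : ℕ) {η : ℝ} (h0 : 0 < η) (h1 : η ≤ 1) :
    expect (samples V s) (fun vs =>
        if (1 - η) * (s * (I.card / Fintype.card V)) ≤
              hits I vs ∧
            hits I vs ≤
              (1 + η) * (s * (I.card / Fintype.card V)) then 0 else 1) ≤
      2 * ENNReal.ofReal (Real.exp (-(s * (I.card / Fintype.card V) * η ^ 2 / 4))) := by
  set μ : ℝ := s * (I.card / Fintype.card V) with hμ
  have hup := samples_tail_le I s (θ := η / 2) (by rw [abs_le]; constructor <;> linarith)
    ((1 + η) * μ)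
  have hlo := samples_tail_le I s (θ := -(η / 2)) (by rw [abs_le]; constructor <;> linarith)
    ((1 - η) * μ)
  have e1 : (s : ℝ) * (I.card / Fintype.card V * (η / 2 + (η / 2) ^ 2)) - η / 2 * ((1 + η) * μ) =
      -(μ * η ^ 2 / 4) := by rw [hμ]; ring
  have e2 : (s : ℝ) * (I.card / Fintype.card V * (-(η / 2) + (-(η / 2)) ^ 2)) -
      -(η / 2) * ((1 - η) * μ) = -(μ * η ^ 2 / 4) := by rw [hμ]; ring
  rw [e1] at hup
  rw [e2] at hlo
  rw [two_mul]
  refine le_trans ?_ (add_le_add hup hlo)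
  rw [← expect_add]
  refine expect_mono _ fun vs _ => ?_
  by_cases hA : (1 - η) * μ ≤ hits I vs
  · by_cases hB : hits I vs ≤ (1 + η) * μ
    · rw [if_pos ⟨hA, hB⟩]
      exact zero_le
    · rw [if_neg (fun h => hB h.2)]
      refine le_trans ?_ le_self_add
      rw [if_pos]
      exact mul_le_mul_of_nonneg_left (not_le.1 hB).le (by linarith)
  · rw [if_neg (fun h => hA h.1)]
    refine le_trans ?_ le_add_self
    rw [if_pos]
    rw [neg_mul, neg_mul, neg_le_neg_iff]
    exact mul_le_mul_of_nonneg_left (not_le.1 hA).le (by linarith)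

end Sampling

/-! ### Independent repetition -/

section Repetition

open Classical

variable {V A R : Type}

/-- Run an algorithm that may give up, at most `ℓ` times independently, until it has a result;
`r₀` is the result if all runs give up. -/
noncomputable def retry (r₀ : R) (𝒜 : RandAlg V A (Option R)) : ℕ → RandAlg V A R
  | 0 => PMF.pure (.done r₀)
  | ℓ + 1 => 𝒜.bind fun D => (retry r₀ 𝒜 ℓ).map fun D' => D.bind fun o =>
      match o with
      | some x => .done x
      | none => D'

theorem retry_queries_le (O : V → V → A) (r₀ : R) (𝒜 : RandAlg V A (Option R)) {q : ℕ}
    (hq : ∀ D ∈ 𝒜.support, D.queries O ≤ q) (ℓ : ℕ) :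
    ∀ D ∈ (retry r₀ 𝒜 ℓ).support, D.queries O ≤ ℓ * q := by
  induction ℓ with
  | zero =>
    intro D hD
    rw [retry, PMF.mem_support_pure_iff] at hD
    simp [hD, QueryAlg.queries]
  | succ ℓ ih =>
    intro D hD
    rw [retry, PMF.mem_support_bind_iff] at hD
    obtain ⟨D₁, h1, hD⟩ := hD
    rw [PMF.mem_support_map_iff] at hD
    obtain ⟨D₂, h2, rfl⟩ := hD
    rw [QueryAlg.queries_bind, add_mul, one_mul, add_comm]
    refine Nat.add_le_add ?_ (hq D₁ h1)
    cases D₁.eval O with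
    | none => exact ih D₂ h2
    | some x => simp [QueryAlg.queries]

/-- A result of `retry` is wrong only if some run gives a wrong result or all runs give up. -/
theorem failProb_retry_le (O : V → V → A) (r₀ : R) (𝒜 : RandAlg V A (Option R)) (P : R → Prop)
    {α β : ℝ≥0∞} (hα : failProb 𝒜 O (fun o => o ≠ none) ≤ α)
    (hβ : failProb 𝒜 O (fun o => ∀ x ∈ o, P x) ≤ β) (hα2 : α * 2 ≤ 1) (ℓ : ℕ) :
    failProb (retry r₀ 𝒜 ℓ) O P ≤ β * 2 + α ^ ℓ := by
  induction ℓ with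
  | zero =>
    rw [pow_zero]
    exact (failProb_le_one _ _ _).trans le_add_self
  | succ ℓ ih =>
    have h1 : failProb (retry r₀ 𝒜 (ℓ + 1)) O P ≤
        failProb 𝒜 O (fun o => ∀ x ∈ o, P x) +
        failProb (retry r₀ 𝒜 ℓ) O P * failProb 𝒜 O (fun o => o ≠ none) := by
      rw [failProb, retry, expect_bind, failProb, failProb, failProb, ← expect_const_mul,
        ← expect_add]
      refine expect_mono _ fun D _ => ?_
      rw [expect_map]
      simp only [QueryAlg.eval_bind]
      cases h : D.eval O with
      | none => simp
      | some x =>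
        simp only [QueryAlg.eval]
        by_cases hx : P x <;> simp [hx, expect_const]
    calc _ ≤ _ := h1
      _ ≤ β + (β * 2 + α ^ ℓ) * α := add_le_add hβ (mul_le_mul' ih hα)
      _ = β + β * (α * 2) + α ^ (ℓ + 1) := by ring
      _ ≤ β + β * 1 + α ^ (ℓ + 1) := by gcongr
      _ = _ := by ring

end Repetition

/-! ### The estimator for the size of a maximal independent set -/

section Estimator

open Classical

variable {n : ℕ}

/-- The deterministic part of the estimator: scan the order `l` greedily while the independent set
has less than `t` elements; if that does not reach the end, then return `γ` times the number of
samples `vs` in the set, or give up if this takes more than `q` queries. -/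
noncomputable def estimatorTree (t q : ℕ) (γ : ℝ) (l vs : List (Fin n)) :
    QueryAlg (Fin n) Bool (Option ℝ) :=
  (scanAlg t l []).bind fun o =>
    match o with
    | some M => .done (some (M : ℝ))
    | none => ((countAlg l vs).truncate q).bind fun o => .done (o.map fun X => γ * (X : ℕ))

/-- The estimator for the size of a random greedy maximal independent set. -/
noncomputable def estimator (n : ℕ) [Nonempty (Fin n)] (t q s : ℕ) (γ : ℝ) :
    RandAlg (Fin n) Bool (Option ℝ) :=
  (randOrder n Finset.univ).bind fun l => (samples (Fin n) s).map fun vs =>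
    estimatorTree t q γ l vs

theorem card_univ_fin (n : ℕ) : (Finset.univ : Finset (Fin n)).card = n := by simp

theorem mem_support_randOrder_univ {l : List (Fin n)}
    (hl : l ∈ (randOrder n Finset.univ).support) : l.Nodup ∧ ∀ v, v ∈ l := by
  obtain ⟨h1, h2⟩ := mem_support_randOrder (card_univ_fin n) hl
  exact ⟨h1, fun v => (h2 v).2 (Finset.mem_univ v)⟩

variable [Nonempty (Fin n)] (G : SimpleGraph (Fin n))

theorem estimator_queries_le {t q s : ℕ} {γ : ℝ} :
    ∀ D ∈ (estimator n t q s γ).support, D.queries (adjOracle G) ≤ t * n + q := by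
  intro D hD
  rw [estimator, PMF.mem_support_bind_iff] at hD
  obtain ⟨l, hl, hD⟩ := hD
  rw [PMF.mem_support_map_iff] at hD
  obtain ⟨vs, -, rfl⟩ := hD
  obtain ⟨h1, h2⟩ := mem_support_randOrder_univ hl
  have hlen : l.length = n := by
    rw [← List.toFinset_card_of_nodup h1]
    convert card_univ_fin n
    ext v
    simp [h2]
  rw [estimatorTree, QueryAlg.queries_bind]
  refine Nat.add_le_add ?_ ?_
  · have := queries_scanAlg_le G t l []
    rwa [hlen] at this
  · cases (scanAlg t l []).eval (adjOracle G) with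
    | some M => simp [QueryAlg.queries]
    | none =>
      simp only [QueryAlg.queries_bind, QueryAlg.queries, add_zero]
      exact QueryAlg.queries_truncate_le _ _ _

/-- The budget is four times the expected number of queries of the tests. -/
theorem estimator_giveUp_le {t s : ℕ} (hs : 0 < s) {γ : ℝ} :
    failProb (estimator n t (4 * (s * n)) s γ) (adjOracle G) (fun o => o ≠ none) ≤ 1 / 4 := by
  have hn : 0 < n := Fin.pos_iff_nonempty.2 inferInstance
  -- the expected number of queries to all samples
  have hcost : expect (randOrder n (Finset.univ : Finset (Fin n))) (fun l =>
      expect (samples (Fin n) s) fun vs =>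
        (((countAlg l vs).queries (adjOracle G) : ℕ) : ℝ≥0∞)) ≤ s * n := by
    have h1 : ∀ l : List (Fin n), (expect (samples (Fin n) s) fun vs =>
        (((countAlg l vs).queries (adjOracle G) : ℕ) : ℝ≥0∞)) =
        (s / n : ℝ≥0∞) * ((∑ v, testCost G (before [] l v) v : ℕ) : ℝ≥0∞) := by
      intro l
      have := expect_samples_sum (V := Fin n) s
        (fun v => (testCost G (before [] l v) v : ℝ≥0∞))
      simp only [queries_countAlg, Nat.cast_list_sum, List.map_map, Function.comp_def, this,
        Fintype.card_fin, Nat.cast_sum, div_eq_mul_inv]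
      ring
    simp only [h1, expect_const_mul]
    have h2 := expect_sum_testCost_le G
    rw [Fintype.card_fin] at h2
    calc _ ≤ (s / n : ℝ≥0∞) * ((n * n : ℕ) : ℝ≥0∞) := by gcongr
      _ = s * (n / n) * n := by push_cast; simp only [div_eq_mul_inv]; ring
      _ = s * n := by
        rw [ENNReal.div_self (by exact_mod_cast hn.ne') (ENNReal.natCast_ne_top n), mul_one]
  calc _ ≤ expect (randOrder n (Finset.univ : Finset (Fin n))) (fun l =>
      expect (samples (Fin n) s) fun vs =>
        if ((4 * (s * n) : ℕ) : ℝ≥0∞) ≤ (((countAlg l vs).queries (adjOracle G) : ℕ) : ℝ≥0∞)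
          then 1 else 0) := by
        rw [failProb, estimator, expect_bind]
        refine expect_mono _ fun l _ => ?_
        rw [expect_map]
        refine expect_mono _ fun vs _ => ?_
        split_ifs with h1 h2
        · exact zero_le
        · exact zero_le
        · exact le_rfl
        · rename_i h2
          refine absurd ?_ h1
          rw [estimatorTree, QueryAlg.eval_bind]
          cases (scanAlg t l []).eval (adjOracle G) with
          | some M => simp [QueryAlg.eval]
          | none =>
            rw [Nat.cast_le, not_le] at h2
            simp [QueryAlg.eval_bind, QueryAlg.eval, QueryAlg.eval_truncate, h2.le]
    _ ≤ expect (randOrder n (Finset.univ : Finset (Fin n))) (fun l =>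
        ((4 * (s * n) : ℕ) : ℝ≥0∞)⁻¹ * expect (samples (Fin n) s) fun vs =>
        (((countAlg l vs).queries (adjOracle G) : ℕ) : ℝ≥0∞)) := by
        refine expect_mono _ fun l _ => ?_
        rw [mul_comm (_⁻¹ : ℝ≥0∞), ← div_eq_mul_inv]
        exact expect_indicator_le_div _ _ (by exact_mod_cast (by positivity))
          (ENNReal.natCast_ne_top _)
    _ ≤ ((4 * (s * n) : ℕ) : ℝ≥0∞)⁻¹ * (s * n) := by
        rw [expect_const_mul]
        gcongr
    _ = 1 / 4 := by
        have h0 : (s : ℝ≥0∞) * n ≠ 0 := by exact_mod_cast (by positivity)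
        have ht : (s : ℝ≥0∞) * n ≠ ⊤ := ENNReal.mul_ne_top (by simp) (by simp)
        push_cast
        rw [ENNReal.mul_inv (Or.inl (by norm_num)) (Or.inl (by norm_num)), mul_assoc,
          ENNReal.inv_mul_cancel h0 ht, mul_one, one_div]

/-- The scan is exact if it reaches the end, and otherwise the set has `M ≥ t` elements. With the
factor `n / (s (1 - η))`, a number of hits within `(1 ± η) s M / n` gives an estimate between `M` and
`(1 + η) / (1 - η) * M`. -/
theorem estimator_wrong_le {t q s : ℕ} (hs : 0 < s) {η : ℝ} (h0 : 0 < η) (h1 : η < 1) :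
    failProb (estimator n t q s (n / (s * (1 - η)))) (adjOracle G)
        (fun o => ∀ x ∈ o, IsMISEstimate ((1 + η) / (1 - η)) G x) ≤
      2 * ENNReal.ofReal (Real.exp (-(s * (t / n) * η ^ 2 / 4))) := by
  have hn : 0 < n := Fin.pos_iff_nonempty.2 inferInstance
  have hnR : (0 : ℝ) < n := by exact_mod_cast hn
  have hsR : (0 : ℝ) < s := by exact_mod_cast hs
  have hη : 0 < 1 - η := by linarith
  rw [failProb, estimator, expect_bind]
  rw [← expect_const (randOrder n (Finset.univ : Finset (Fin n)))
    (2 * ENNReal.ofReal (Real.exp (-(s * (t / n) * η ^ 2 / 4))))]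
  refine expect_mono _ fun l hl => ?_
  rw [expect_map]
  obtain ⟨hnd, hmem⟩ := mem_support_randOrder_univ hl
  set I := greedySet G (l.reverseAux []) with hI
  have hMIS : IsMIS G I := isMIS_greedySet fun v => by
    rw [List.reverseAux_eq, List.append_nil, List.mem_reverse]
    exact hmem v
  rcases eval_scanAlg G t (r := []) (J := []) hnd (by simp) (by simp [greedySet])
    (by simp [greedySet]) with hscan | ⟨hscan, ht⟩
  · refine (expect_mono (g := fun _ => 0) _ fun vs _ => ?_).trans
      ((expect_const _ _).trans_le zero_le)
    rw [if_pos]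
    intro x hx
    rw [estimatorTree, QueryAlg.eval_bind, hscan] at hx
    simp only [QueryAlg.eval, Option.mem_def, Option.some.injEq] at hx
    subst hx
    refine ⟨I, hMIS, le_rfl, ?_⟩
    have : (1 : ℝ) ≤ (1 + η) / (1 - η) := by rw [one_le_div hη]; linarith
    exact le_mul_of_one_le_left (by positivity) this
  · have hch := samples_chernoff I s h0 h1.le
    refine le_trans (expect_mono _ fun vs _ => ?_) (hch.trans ?_)
    · split_ifs with ha hb hb
      · exact zero_le
      · exact zero_le
      · refine absurd ?_ ha
        intro x hx
        rw [estimatorTree, QueryAlg.eval_bind, hscan] at hx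
        simp only [QueryAlg.eval_bind, QueryAlg.eval, QueryAlg.eval_truncate, Option.mem_def,
          Option.map_eq_some_iff] at hx
        obtain ⟨X, hX, rfl⟩ := hx
        have hX' : hits I vs = X := by
          split_ifs at hX
          rw [Option.some.injEq, eval_countAlg] at hX
          rw [← hX, hits]
          congr 1
          refine List.map_congr_left fun v _ => ?_
          simp only [hI, mem_greedySet_reverseAux hnd (hmem v) List.not_mem_nil]
        rw [hX', Fintype.card_fin] at hb
        obtain ⟨hb1, hb2⟩ := hb
        refine ⟨I, hMIS, ?_, ?_⟩
        · calc (I.card : ℝ) = n / (s * (1 - η)) * ((1 - η) * (s * (I.card / n))) := by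
                field_simp
            _ ≤ _ := mul_le_mul_of_nonneg_left hb1 (by positivity)
        · calc _ ≤ n / (s * (1 - η)) * ((1 + η) * (s * (I.card / n))) :=
                mul_le_mul_of_nonneg_left hb2 (by positivity)
            _ = _ := by field_simp
      · exact le_rfl
    · rw [Fintype.card_fin]
      gcongr

theorem exists_estimatesMIS {t s : ℕ} (hs : 0 < s) {η : ℝ} (h0 : 0 < η) (h1 : η < 1) (ℓ : ℕ)
    {δ : ℝ} (hδ : 4 * Real.exp (-(s * (t / n) * η ^ 2 / 4)) + Real.exp (-ℓ) ≤ δ) :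
    ∃ 𝒜 : RandAlg (Fin n) Bool ℝ,
      EstimatesMIS ((1 + η) / (1 - η)) δ (ℓ * (t * n + 4 * (s * n))) 𝒜 := by
  have hδ0 : 0 ≤ δ := le_trans (by positivity) hδ
  refine ⟨retry 0 (estimator n t (4 * (s * n)) s (n / (s * (1 - η)))) ℓ, fun G => ⟨?_, ?_⟩⟩
  · intro D hD
    exact_mod_cast retry_queries_le (adjOracle G) _ _ (estimator_queries_le G) ℓ D hD
  · rw [one_sub_le_prob_iff _ _ _ hδ0]
    have hquarter : (1 / 4 : ℝ≥0∞) = ENNReal.ofReal (1 / 4) := by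
      rw [ENNReal.ofReal_div_of_pos (by norm_num)]
      norm_num
    refine (failProb_retry_le _ _ _ _ (estimator_giveUp_le G hs) (estimator_wrong_le G hs h0 h1)
      ?_ ℓ).trans ?_
    · rw [hquarter, ← ENNReal.ofReal_ofNat, ← ENNReal.ofReal_mul (by norm_num),
        ENNReal.ofReal_le_one]
      norm_num
    · rw [hquarter, ← ENNReal.ofReal_ofNat, ← ENNReal.ofReal_mul (by norm_num),
        ← ENNReal.ofReal_mul (by positivity), ← ENNReal.ofReal_pow (by norm_num),
        ← ENNReal.ofReal_add (by positivity) (by positivity)]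
      refine ENNReal.ofReal_le_ofReal (le_trans ?_ hδ)
      have h4 : (1 / 4 : ℝ) ^ ℓ ≤ Real.exp (-ℓ) := by
        have : Real.exp (-ℓ) = (Real.exp (-1)) ^ ℓ := by
          rw [← Real.exp_nat_mul]
          congr 1
          ring
        rw [this]
        refine pow_le_pow_left₀ (by norm_num) ?_ ℓ
        rw [Real.exp_neg, one_div]
        exact inv_anti₀ (Real.exp_pos 1) (by linarith [Real.exp_one_lt_d9])
      linarith

end Estimator

/-! ### `T_MIS = Õ(n^{3/2})` -/

section UpperBound

theorem half_le_log_succ {n : ℕ} (hn : 1 ≤ n) : (1 / 2 : ℝ) ≤ Real.log (n + 1) := by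
  have h1 : (2 : ℝ) ≤ (n : ℝ) + 1 := by
    have : (1 : ℝ) ≤ n := by exact_mod_cast hn
    linarith
  have h2 := Real.log_le_log (by norm_num) h1
  linarith [Real.log_two_gt_d9]

/-- The cost of the estimator with `⌈√n⌉` scan steps, `O(√n log n)` samples and `O(log n)`
repetitions. -/
theorem exists_estimatesMIS_le {c : ℝ} (hc : 1 < c) (d : ℕ) :
    ∃ C : ℝ, 0 < C ∧ ∀ n : ℕ, 1 ≤ n → ∃ (q : ℕ) (𝒜 : RandAlg (Fin n) Bool ℝ),
      EstimatesMIS c (1 / (n : ℝ) ^ d) q 𝒜 ∧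
        (q : ℝ) ≤ C * (n : ℝ) ^ (3 / 2 : ℝ) * Real.log (n + 1) ^ 2 := by
  -- the accuracy for which `(1 + η) / (1 - η) = c`
  set η : ℝ := (c - 1) / (c + 1) with hη
  have h0 : 0 < η := by rw [hη]; apply div_pos <;> linarith
  have h1 : η < 1 := by rw [hη, div_lt_one] <;> linarith
  have hcη : (1 + η) / (1 - η) = c := by
    have : c + 1 ≠ 0 := by linarith
    have e1 : 1 + η = 2 * c / (c + 1) := by rw [hη]; field_simp; ring
    have e2 : 1 - η = 2 / (c + 1) := by rw [hη]; field_simp; ring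
    rw [e1, e2]
    field_simp
  set K : ℝ := d + 3 with hK
  have hK0 : 0 < K := by positivity
  refine ⟨(K + 2) * (4 + 4 * (4 * K / η ^ 2 + 2)), by positivity, fun n hn => ?_⟩
  have : Nonempty (Fin n) := ⟨⟨0, hn⟩⟩
  have hnR : (1 : ℝ) ≤ n := by exact_mod_cast hn
  have hn0 : (0 : ℝ) < n := by linarith
  set Λ := Real.log ((n : ℝ) + 1) with hΛ
  have hΛ2 : 1 / 2 ≤ Λ := half_le_log_succ hn
  have hΛ0 : 0 < Λ := by linarith
  set R := Real.sqrt n with hR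
  have hR1 : 1 ≤ R := Real.one_le_sqrt.2 hnR
  have hRR : R * R = n := Real.mul_self_sqrt hn0.le
  set t := ⌈R⌉₊
  set s := ⌈4 * K / η ^ 2 * R * Λ⌉₊
  set ℓ := ⌈K * Λ⌉₊
  have hs : 0 < s := Nat.ceil_pos.2 (by positivity)
  have hexp : Real.exp (-(K * Λ)) = 1 / ((n : ℝ) + 1) ^ (d + 3) := by
    have : -(K * Λ) = -((d + 3 : ℕ) * Λ) := by rw [hK]; push_cast; ring
    rw [this, Real.exp_neg, Real.exp_nat_mul, hΛ, Real.exp_log (by linarith), one_div]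
  have hδ : 4 * Real.exp (-(s * (t / n) * η ^ 2 / 4)) + Real.exp (-ℓ) ≤ 1 / (n : ℝ) ^ d := by
    have e1 : K * Λ ≤ s * (t / n) * η ^ 2 / 4 := by
      have hs' : 4 * K / η ^ 2 * R * Λ ≤ s := Nat.le_ceil _
      have ht' : R ≤ t := Nat.le_ceil _
      calc K * Λ = (4 * K / η ^ 2 * R * Λ) * (R / n) * η ^ 2 / 4 := by
            rw [← hRR]
            field_simp
        _ ≤ s * (t / n) * η ^ 2 / 4 := by gcongr
    have e2 : K * Λ ≤ ℓ := Nat.le_ceil _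
    have e3 : Real.exp (-(s * (t / n) * η ^ 2 / 4)) ≤ 1 / ((n : ℝ) + 1) ^ (d + 3) := by
      rw [← hexp]
      exact Real.exp_le_exp.2 (by linarith)
    have e4 : Real.exp (-ℓ) ≤ 1 / ((n : ℝ) + 1) ^ (d + 3) := by
      rw [← hexp]
      exact Real.exp_le_exp.2 (by linarith)
    have e5 : 8 * (1 / ((n : ℝ) + 1) ^ (d + 3)) ≤ 1 / ((n : ℝ) + 1) ^ d := by
      rw [pow_add, mul_one_div, div_le_div_iff₀ (by positivity) (by positivity), one_mul, mul_comm]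
      gcongr
      calc (8 : ℝ) = 2 ^ 3 := by norm_num
        _ ≤ ((n : ℝ) + 1) ^ 3 := by gcongr; linarith
    have e6 : 1 / ((n : ℝ) + 1) ^ d ≤ 1 / (n : ℝ) ^ d := by
      gcongr
      linarith
    have e7 : 0 ≤ 1 / ((n : ℝ) + 1) ^ (d + 3) := by positivity
    linarith
  obtain ⟨𝒜, h𝒜⟩ := exists_estimatesMIS (t := t) hs h0 h1 ℓ hδ
  rw [hcη] at h𝒜
  refine ⟨_, 𝒜, h𝒜, ?_⟩
  have hpow : (n : ℝ) ^ (3 / 2 : ℝ) = n * R := by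
    rw [show (3 / 2 : ℝ) = 1 + 1 / 2 by norm_num, Real.rpow_add hn0, Real.rpow_one, hR,
      Real.sqrt_eq_rpow]
  have b1 : (t : ℝ) ≤ 4 * R * Λ := by
    have := (Nat.ceil_lt_add_one (a := R) (by positivity)).le
    nlinarith
  have b2 : (s : ℝ) ≤ (4 * K / η ^ 2 + 2) * R * Λ := by
    have := (Nat.ceil_lt_add_one (a := 4 * K / η ^ 2 * R * Λ) (by positivity)).le
    nlinarith
  have b3 : (ℓ : ℝ) ≤ (K + 2) * Λ := by
    have := (Nat.ceil_lt_add_one (a := K * Λ) (by positivity)).le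
    nlinarith
  rw [hpow]
  push_cast
  calc (ℓ : ℝ) * (t * n + 4 * (s * n))
      ≤ ((K + 2) * Λ) * ((4 * R * Λ) * n + 4 * (((4 * K / η ^ 2 + 2) * R * Λ) * n)) := by gcongr
    _ = _ := by ring

theorem exists_estimatesMIS_misComplexity {c : ℝ} (hc : 1 < c) (d : ℕ) {n : ℕ} (hn : 1 ≤ n) :
    ∃ 𝒜 : RandAlg (Fin n) Bool ℝ,
      EstimatesMIS c (1 / (n : ℝ) ^ d) (misComplexity c (1 / (n : ℝ) ^ d) n) 𝒜 := by
  obtain ⟨C, -, h⟩ := exists_estimatesMIS_le hc d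
  obtain ⟨q, 𝒜, h𝒜, -⟩ := h n hn
  exact Nat.sInf_mem (s := {q | ∃ 𝒜 : RandAlg (Fin n) Bool ℝ,
    EstimatesMIS c (1 / (n : ℝ) ^ d) q 𝒜}) ⟨q, 𝒜, h𝒜⟩

theorem TMIS_le {c : ℝ} (hc : 1 < c) (d : ℕ) :
    ∃ C : ℝ, 0 < C ∧ ∀ n : ℕ, 1 ≤ n →
      TMIS c d n ≤ C * (n : ℝ) ^ (3 / 2 : ℝ) * Real.log (n + 1) ^ 2 := by
  obtain ⟨C, hC, h⟩ := exists_estimatesMIS_le hc d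
  refine ⟨C + 4, by linarith, fun n hn => ?_⟩
  obtain ⟨q, 𝒜, h𝒜, hq⟩ := h n hn
  have h1 : (misComplexity c (1 / (n : ℝ) ^ d) n : ℝ) ≤ q := by
    exact_mod_cast Nat.sInf_le (s := {q | ∃ 𝒜 : RandAlg (Fin n) Bool ℝ,
      EstimatesMIS c (1 / (n : ℝ) ^ d) q 𝒜}) ⟨𝒜, h𝒜⟩
  have h2 : (1 : ℝ) ≤ (n : ℝ) ^ (3 / 2 : ℝ) :=
    Real.one_le_rpow (by exact_mod_cast hn) (by norm_num)
  have h3 := half_le_log_succ hn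
  have h4 : (1 : ℝ) ≤ 4 * ((n : ℝ) ^ (3 / 2 : ℝ) * Real.log (n + 1) ^ 2) := by
    have : (1 / 4 : ℝ) ≤ Real.log (n + 1) ^ 2 := by nlinarith
    nlinarith
  have h5 : 0 ≤ C * ((n : ℝ) ^ (3 / 2 : ℝ) * Real.log (n + 1) ^ 2) := by positivity
  rw [TMIS]
  refine max_le ?_ ?_ <;> nlinarith

theorem one_le_TMIS (c : ℝ) (d n : ℕ) : 1 ≤ TMIS c d n := le_max_left _ _

end UpperBound

/-! ### `T_MIS = Ω(n)` -/

section LowerBound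

open Classical

variable {n m : ℕ}

/-- The disjoint union of cliques on the colour classes of `f`. -/
def colorGraph (f : Fin n → Fin m) : SimpleGraph (Fin n) :=
  SimpleGraph.fromRel fun u v => f u = f v

theorem card_collisions_mul_le {u v : Fin n} (huv : u ≠ v) :
    (Finset.univ.filter fun f : Fin n → Fin m => f u = f v).card * m ≤ m ^ n := by
  have h1 : (Finset.univ.filter fun f : Fin n → Fin m => f u = f v).card * m =
      ((Finset.univ.filter fun f : Fin n → Fin m => f u = f v) ×ˢ
        (Finset.univ : Finset (Fin m))).card := by simp
  have h2 : m ^ n = (Finset.univ : Finset (Fin n → Fin m)).card := by simp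
  rw [h1, h2]
  refine Finset.card_le_card_of_injOn (fun p => Function.update p.1 u p.2) (by simp) ?_
  rintro ⟨f, a⟩ hf ⟨g, b⟩ hg hfg
  simp only [Finset.coe_product, Set.mem_prod, Finset.mem_coe, Finset.mem_filter, Finset.mem_univ,
    true_and, and_true] at hf hg hfg
  have key : ∀ w, w ≠ u → f w = g w := by
    intro w hw
    have := congrFun hfg w
    rwa [Function.update_of_ne hw, Function.update_of_ne hw] at this
  have hab : a = b := by simpa using congrFun hfg u
  have : f = g := by
    funext w
    by_cases hw : w = u
    · rw [hw, hf, hg, key v huv.symm]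
    · exact key w hw
  rw [this, hab]

/-- With few queries, a deterministic algorithm does not distinguish most graphs of colour classes
from the empty graph. -/
theorem card_distinguished_mul_le {R : Type} (D : QueryAlg (Fin n) Bool R) :
    (Finset.univ.filter fun f : Fin n → Fin m =>
      D.eval (adjOracle (colorGraph f)) ≠ D.eval (adjOracle ⊥)).card * m ≤
      D.queries (adjOracle (⊥ : SimpleGraph (Fin n))) * m ^ n := by
  induction D with
  | done r => simp [QueryAlg.eval]
  | query u v next ih =>
    have hbot : adjOracle (⊥ : SimpleGraph (Fin n)) u v = false := by simp [adjOracle]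
    have hsub : (Finset.univ.filter fun f : Fin n → Fin m =>
        (QueryAlg.query u v next).eval (adjOracle (colorGraph f)) ≠
          (QueryAlg.query u v next).eval (adjOracle ⊥)) ⊆
        (Finset.univ.filter fun f : Fin n → Fin m => u ≠ v ∧ f u = f v) ∪
        (Finset.univ.filter fun f : Fin n → Fin m =>
          (next false).eval (adjOracle (colorGraph f)) ≠ (next false).eval (adjOracle ⊥)) := by
      intro f hf
      simp only [Finset.mem_union, Finset.mem_filter, Finset.mem_univ, true_and] at hf ⊢
      by_cases h : u ≠ v ∧ f u = f v
      · exact Or.inl h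
      · refine Or.inr ?_
        have : adjOracle (colorGraph f) u v = false := by
          simp only [adjOracle, colorGraph, SimpleGraph.fromRel_adj, decide_eq_false_iff_not]
          exact fun h' => h ⟨h'.1, h'.2.elim id Eq.symm⟩
        rwa [QueryAlg.eval, QueryAlg.eval, this, hbot] at hf
    have h1 : (Finset.univ.filter fun f : Fin n → Fin m => u ≠ v ∧ f u = f v).card * m ≤ m ^ n := by
      by_cases huv : u = v
      · simp [huv]
      · simpa [huv] using card_collisions_mul_le (m := m) huv
    calc _ ≤ ((Finset.univ.filter fun f : Fin n → Fin m => u ≠ v ∧ f u = f v).card +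
        (Finset.univ.filter fun f : Fin n → Fin m =>
          (next false).eval (adjOracle (colorGraph f)) ≠
            (next false).eval (adjOracle ⊥)).card) * m :=
          Nat.mul_le_mul_right _ ((Finset.card_le_card hsub).trans (Finset.card_union_le _ _))
      _ ≤ m ^ n + (next false).queries (adjOracle (⊥ : SimpleGraph (Fin n))) * m ^ n := by
          rw [add_mul]
          exact Nat.add_le_add h1 (ih false)
      _ = _ := by
          rw [QueryAlg.queries, hbot]
          ring

theorem IsMISEstimate.le_of_colorGraph {f : Fin n → Fin m} {c x : ℝ} (hc : 0 ≤ c)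
    (h : IsMISEstimate c (colorGraph f) x) : x ≤ c * m := by
  obtain ⟨U, hU, -, hx⟩ := h
  have hcard : U.card ≤ m := by
    have : Set.InjOn f U := by
      intro u hu v hv huv
      by_contra hne
      exact hU.prop hu hv hne (by simp [colorGraph, SimpleGraph.fromRel_adj, hne, huv])
    simpa using Finset.card_le_card_of_injOn f
      (fun _ _ => Finset.mem_coe.2 (Finset.mem_univ _)) this
  have : (U.card : ℝ) ≤ m := by exact_mod_cast hcard
  exact hx.trans (mul_le_mul_of_nonneg_left this hc)

theorem IsMISEstimate.le_of_bot {c x : ℝ}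
    (h : IsMISEstimate c (⊥ : SimpleGraph (Fin n)) x) : (n : ℝ) ≤ x := by
  obtain ⟨U, hU, hx, -⟩ := h
  have : U = Finset.univ := by
    refine Finset.eq_univ_of_forall fun v => ?_
    by_contra hv
    obtain ⟨u, -, hadj⟩ := hU.exists_adj_of_notMem hv
    exact hadj
  rwa [this, Finset.card_univ, Fintype.card_fin] at hx

/-- An estimate for the empty graph is never an estimate for a union of `m < n / c` cliques, so the
two kinds of graphs have to be distinguished. -/
theorem le_queries_of_estimatesMIS {c δ : ℝ} (hc : 0 ≤ c) (hδ0 : 0 ≤ δ) (hδ : δ ≤ 1 / 4)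
    (hm : 0 < m) (hcm : c * m < n) {q : ℕ} {𝒜 : RandAlg (Fin n) Bool ℝ}
    (h𝒜 : EstimatesMIS c δ q 𝒜) : (m : ℝ) / 2 ≤ q := by
  have hfail : ∀ G, failProb 𝒜 (adjOracle G) (IsMISEstimate c G) ≤ ENNReal.ofReal δ := fun G =>
    (one_sub_le_prob_iff _ _ _ hδ0).1 (h𝒜 G).2
  have hone : ∀ f : Fin n → Fin m, (1 : ℝ≥0∞) ≤ ENNReal.ofReal δ + ENNReal.ofReal δ +
      expect 𝒜 (fun D => if D.eval (adjOracle (colorGraph f)) ≠ D.eval (adjOracle ⊥)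
        then 1 else 0) := by
    intro f
    refine le_trans ?_ (add_le_add_left (add_le_add (hfail ⊥) (hfail (colorGraph f))) _)
    rw [failProb, failProb, ← expect_add, ← expect_add]
    refine (expect_const 𝒜 1).symm.trans_le (expect_mono _ fun D _ => ?_)
    by_cases h1 : D.eval (adjOracle (colorGraph f)) = D.eval (adjOracle ⊥)
    · by_cases h2 : IsMISEstimate c (⊥ : SimpleGraph (Fin n)) (D.eval (adjOracle ⊥))
      · by_cases h3 : IsMISEstimate c (colorGraph f) (D.eval (adjOracle (colorGraph f)))
        · rw [h1] at h3
          linarith [h2.le_of_bot, h3.le_of_colorGraph hc]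
        · rw [if_neg h3]
          exact le_add_self.trans le_self_add
      · rw [if_neg h2]
        exact le_self_add.trans le_self_add
    · rw [if_pos h1]
      exact le_add_self
  have hN : (0 : ℝ) < (m : ℝ) ^ n := by positivity
  have hsum : ((m ^ n : ℕ) : ℝ≥0∞) ≤ ((m ^ n : ℕ) : ℝ≥0∞) * ENNReal.ofReal (2 * δ) +
      ENNReal.ofReal (q * (m : ℝ) ^ n / m) := by
    have hcardU : (Finset.univ : Finset (Fin n → Fin m)).card = m ^ n := by simp
    have := Finset.sum_le_sum fun f (_ : f ∈ (Finset.univ : Finset (Fin n → Fin m))) => hone f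
    rw [Finset.sum_const, Finset.sum_add_distrib, Finset.sum_const, hcardU, nsmul_eq_mul,
      nsmul_eq_mul, mul_one, ← expect_sum, ← ENNReal.ofReal_add hδ0 hδ0, ← two_mul] at this
    refine this.trans (add_le_add_right ?_ _)
    rw [← expect_const 𝒜 (ENNReal.ofReal _)]
    refine expect_mono _ fun D hD => ?_
    have hq := (h𝒜 ⊥).1 D hD
    have hcount := card_distinguished_mul_le (m := m) D
    rw [Finset.sum_ite, Finset.sum_const_zero, add_zero, Finset.sum_const, nsmul_one,
      ← ENNReal.ofReal_natCast]
    refine ENNReal.ofReal_le_ofReal ?_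
    rw [le_div_iff₀ (by exact_mod_cast hm)]
    calc _ ≤ (D.queries (adjOracle (⊥ : SimpleGraph (Fin n))) : ℝ) * (m : ℝ) ^ n := by
          exact_mod_cast hcount
      _ ≤ _ := by gcongr
  have hreal : (m : ℝ) ^ n ≤ (m : ℝ) ^ n * (2 * δ) + q * (m : ℝ) ^ n / m := by
    rw [← ENNReal.ofReal_natCast, ← ENNReal.ofReal_mul (by positivity),
      ← ENNReal.ofReal_add (by positivity) (by positivity),
      ENNReal.ofReal_le_ofReal_iff (by positivity)] at hsum
    exact_mod_cast hsum
  have hmR : (0 : ℝ) < m := by exact_mod_cast hm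
  have h2 : (m : ℝ) ^ n * 1 ≤ (m : ℝ) ^ n * (2 * δ + q / m) := by
    calc _ = (m : ℝ) ^ n := mul_one _
      _ ≤ _ := hreal
      _ = _ := by ring
  have h3 := le_of_mul_le_mul_left h2 hN
  have h4 : (1 / 2 : ℝ) ≤ q / m := by linarith
  rw [le_div_iff₀ hmR] at h4
  linarith

theorem le_TMIS {c : ℝ} (hc : 1 < c) (d n : ℕ) : (n : ℝ) ≤ 8 * c * TMIS c (d + 1) n := by
  have hT := one_le_TMIS c (d + 1) n
  by_cases hn : (n : ℝ) < 4 * c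
  · nlinarith
  · push Not at hn
    have hn4 : (4 : ℝ) ≤ n := by linarith
    have hn1 : 1 ≤ n := by
      have : (1 : ℝ) ≤ n := by linarith
      exact_mod_cast this
    obtain ⟨𝒜, h𝒜⟩ := exists_estimatesMIS_misComplexity hc (d + 1) hn1
    have hx : 2 ≤ (n : ℝ) / (2 * c) := by rw [le_div_iff₀ (by linarith)]; linarith
    have hfl : (⌊(n : ℝ) / (2 * c)⌋₊ : ℝ) ≤ n / (2 * c) := Nat.floor_le (by linarith)
    have hfl' := Nat.lt_floor_add_one ((n : ℝ) / (2 * c))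
    have hδ : 1 / (n : ℝ) ^ (d + 1) ≤ 1 / 4 := by
      refine one_div_le_one_div_of_le (by norm_num) ?_
      calc (4 : ℝ) ≤ n := hn4
        _ = (n : ℝ) ^ 1 := (pow_one _).symm
        _ ≤ (n : ℝ) ^ (d + 1) := pow_le_pow_right₀ (by linarith) (by omega)
    have key := le_queries_of_estimatesMIS (m := ⌊(n : ℝ) / (2 * c)⌋₊) (by linarith)
      (by positivity) hδ (Nat.floor_pos.2 (by linarith)) (by
        calc c * (⌊(n : ℝ) / (2 * c)⌋₊ : ℝ) ≤ c * (n / (2 * c)) :=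
              mul_le_mul_of_nonneg_left hfl (by linarith)
          _ = n / 2 := by field_simp
          _ < n := by linarith) h𝒜
    have hle : (misComplexity c (1 / (n : ℝ) ^ (d + 1)) n : ℝ) ≤ TMIS c (d + 1) n :=
      le_max_right _ _
    have h5 : (n : ℝ) / (2 * c) ≤ 4 * TMIS c (d + 1) n := by linarith
    rw [div_le_iff₀ (by linarith)] at h5
    linarith

end LowerBound

/-! ### Estimates for all levels -/

section BallEstimates

theorem exists_isMIS {α : Type} [Finite α] (G : SimpleGraph α) : ∃ U, IsMIS G U := by
  have := Fintype.ofFinite α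
  refine ⟨greedySet G Finset.univ.toList, isMIS_greedySet fun v => ?_⟩
  simp

theorem lastLevel_add_one_le {k : ℕ} (hk : 1 ≤ k) :
    ((lastLevel k + 1 : ℕ) : ℝ) ≤ 6 * Real.log (k + 1) := by
  have hkR : (1 : ℝ) ≤ k := by exact_mod_cast hk
  have h1 : (2 : ℝ) ^ lastLevel k ≤ 4 * k := by
    exact_mod_cast Nat.pow_log_le_self 2 (by omega : 4 * k ≠ 0)
  have h2 := Real.log_le_log (by positivity) h1
  rw [Real.log_pow, Real.log_mul (by norm_num) (by positivity),
    show (4 : ℝ) = 2 ^ 2 by norm_num, Real.log_pow] at h2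
  have h3 : Real.log k ≤ Real.log (k + 1) := Real.log_le_log (by linarith) (by linarith)
  have h4 : Real.log 2 ≤ Real.log (k + 1) := Real.log_le_log (by norm_num) (by linarith)
  have h5 := Real.log_two_gt_d9
  push_cast at h2 ⊢
  have h6 : ((lastLevel k : ℝ) + 1) * Real.log 2 ≤ 4 * Real.log (k + 1) := by linarith
  have h7 : (0 : ℝ) ≤ lastLevel k := by positivity
  nlinarith

variable {V : Type} {k : ℕ}

theorem dist_le_maxPairDist (w : V → V → ℝ) (T : Fin k → V × V) (j : Fin k) :
    w (T j).1 (T j).2 ≤ maxPairDist w T :=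
  le_ciSup (f := fun j => w (T j).1 (T j).2) (Set.finite_range _).bddAbove j

theorem exists_eq_maxPairDist (hk : 1 ≤ k) (w : V → V → ℝ) (T : Fin k → V × V) :
    ∃ j, w (T j).1 (T j).2 = maxPairDist w T := by
  have : Nonempty (Fin k) := ⟨⟨0, hk⟩⟩
  exact exists_eq_ciSup_of_finite

theorem unitLength_mul (hk : 1 ≤ k) (w : V → V → ℝ) (T : Fin k → V × V) :
    4 * k * unitLength w T = maxPairDist w T := by
  have : (k : ℝ) ≠ 0 := by positivity
  rw [unitLength]
  field_simp

theorem exists_active_of_le_lastLevel (hk : 1 ≤ k) {w : V → V → ℝ} (hw : ∀ u v, 0 ≤ w u v)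
    (T : Fin k → V × V) {i : ℕ} (hi : i ≤ lastLevel k) :
    ∃ v, Active w T (threshold (unitLength w T) i) v := by
  obtain ⟨j, hj⟩ := exists_eq_maxPairDist hk w T
  refine ⟨(T j).1, j, Or.inl rfl, ?_⟩
  have h1 : (2 : ℝ) ^ i ≤ 4 * k := by
    exact_mod_cast (Nat.pow_le_pow_right (by norm_num) hi).trans
      (Nat.pow_log_le_self 2 (by omega : 4 * k ≠ 0))
  have h2 : 0 ≤ unitLength w T := by
    rw [unitLength, ← hj]
    exact div_nonneg (hw _ _) (by positivity)
  rw [hj, ← unitLength_mul hk, threshold, mul_comm]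
  exact mul_le_mul_of_nonneg_right h1 h2

variable [Fintype V]

theorem exists_isBallEstimate {c : ℝ} (hc : 1 ≤ c) (w : V → V → ℝ) (T : Fin k → V × V) :
    ∃ x, IsBallEstimate c w T x := by
  choose U hU using fun i => exists_isMIS (ballGraph w T (threshold (unitLength w T) i))
  exact ⟨_, fun i => (U i).card, fun i _ => ⟨U i, hU i, le_rfl,
    le_mul_of_one_le_left (by positivity) hc⟩, rfl⟩

/-- The sandwich for the sum of the estimates. If all pairs have distance zero, then all thresholds
and the optimum vanish. -/
theorem IsBallEstimate.opt_le_and_le [PseudoMetricSpace V] (hk : 1 ≤ k) {c : ℝ} (hc : 1 < c)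
    {T : Fin k → V × V} {x : ℝ} (h : IsBallEstimate c dist T x) :
    opt dist T ≤ 6 * x ∧ x ≤ 6 * c * Real.log (k + 1) * opt dist T := by
  classical
  obtain ⟨Mhat, hM, rfl⟩ := h
  obtain ⟨j, hj⟩ := exists_eq_maxPairDist hk dist T
  have hX : 0 ≤ maxPairDist dist T := by rw [← hj]; exact dist_nonneg
  have hlog := lastLevel_add_one_le hk
  have hopt : 0 ≤ opt dist T := by
    obtain ⟨F, -, hF⟩ := (isLeast_opt (dist : V → V → ℝ) T).1
    rw [← hF]
    exact Finset.sum_nonneg fun _ _ => dist_nonneg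
  rcases hX.eq_or_lt with hX0 | hX0
  · have hτ : ∀ i, threshold (unitLength dist T) i = 0 := by
      intro i
      simp [threshold, unitLength, ← hX0]
    have hzero : opt dist T ≤ 0 := by
      refine (opt_le_weight (F := Finset.univ.image T) fun j =>
        edgeGraph_reachable_of_mem (Finset.mem_image_of_mem T (Finset.mem_univ j))).trans ?_
      refine Finset.sum_nonpos fun e he => ?_
      obtain ⟨j, -, rfl⟩ := Finset.mem_image.1 he
      rw [hX0]
      exact dist_le_maxPairDist dist T j
    simp only [hτ, mul_zero, Finset.sum_const_zero]
    refine ⟨hzero, ?_⟩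
    have : 0 ≤ Real.log ((k : ℝ) + 1) := Real.log_nonneg (by linarith [k.cast_nonneg (α := ℝ)])
    have hc0 : 0 ≤ c := by linarith
    positivity
  · have hkR : (0 : ℝ) < k := by positivity
    have hσ : 0 < unitLength dist T := by rw [unitLength]; positivity
    have hex : ∀ i, ∃ U : Finset {v : V // Active dist T (threshold (unitLength dist T) i) v},
        i ≤ lastLevel k → IsMIS (ballGraph dist T (threshold (unitLength dist T) i)) U ∧
          (U.card : ℝ) ≤ Mhat i ∧ Mhat i ≤ c * U.card := by
      intro i
      by_cases hi : i ≤ lastLevel k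
      · obtain ⟨U, hU⟩ := hM i (Finset.mem_range.2 (by omega))
        exact ⟨U, fun _ => hU⟩
      · exact ⟨∅, fun h => absurd h hi⟩
    choose U hU using hex
    constructor
    · refine (opt_le_of_far_pair hσ (lastLevel k) U (fun i hi => (hU i hi).1) (fun j => ?_)
        ⟨j, by rw [unitLength_mul hk, hj]⟩).trans ?_
      · refine (dist_le_maxPairDist dist T j).trans_lt ?_
        rw [← unitLength_mul hk, threshold, mul_comm]
        refine mul_lt_mul_of_pos_left ?_ hσ
        exact_mod_cast Nat.lt_pow_succ_log_self (b := 2) (by norm_num) (4 * k)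
      · refine mul_le_mul_of_nonneg_left (Finset.sum_le_sum fun i hi => ?_) (by norm_num)
        exact mul_le_mul_of_nonneg_right (hU i (by rw [Finset.mem_range] at hi; omega)).2.1
          (threshold_pos hσ i).le
    · calc ∑ i ∈ Finset.range (lastLevel k + 1), Mhat i * threshold (unitLength dist T) i
          ≤ ∑ i ∈ Finset.range (lastLevel k + 1), c * opt dist T := by
            refine Finset.sum_le_sum fun i hi => ?_
            have hi' : i ≤ lastLevel k := by rw [Finset.mem_range] at hi; omega
            have h1 := card_mul_le_opt T (threshold_pos hσ i) (U i) (hU i hi').1.prop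
            calc _ ≤ (c * (U i).card) * threshold (unitLength dist T) i :=
                  mul_le_mul_of_nonneg_right (hU i hi').2.2 (threshold_pos hσ i).le
              _ = c * ((U i).card * threshold (unitLength dist T) i) := by ring
              _ ≤ _ := mul_le_mul_of_nonneg_left h1 (by linarith)
        _ = ((lastLevel k + 1 : ℕ) : ℝ) * (c * opt dist T) := by simp
        _ ≤ (6 * Real.log (k + 1)) * (c * opt dist T) :=
            mul_le_mul_of_nonneg_right hlog (mul_nonneg (by linarith) hopt)
        _ = _ := by ring

end BallEstimates

/-! ### Blow-ups of graphs -/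

section BlowUp

variable {V α : Type}

/-- The graph on `V` in which every vertex `a` of `H` is replaced by a clique on the fibre of `φ`
over `a`. -/
def blowUp (H : SimpleGraph α) (φ : V → α) : SimpleGraph V :=
  SimpleGraph.fromRel fun u v => φ u = φ v ∨ H.Adj (φ u) (φ v)

theorem blowUp_adj {H : SimpleGraph α} {φ : V → α} {u v : V} :
    (blowUp H φ).Adj u v ↔ u ≠ v ∧ (φ u = φ v ∨ H.Adj (φ u) (φ v)) := by
  rw [blowUp, SimpleGraph.fromRel_adj, eq_comm (a := φ v), H.adj_comm (φ v), or_self]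

/-- The maximal independent sets of a blow-up project bijectively to those of the graph. -/
theorem IsMISEstimate.of_blowUp {H : SimpleGraph α} {φ : V → α} (hφ : Function.Surjective φ)
    {c x : ℝ} (h : IsMISEstimate c (blowUp H φ) x) : IsMISEstimate c H x := by
  classical
  obtain ⟨U, hU, h1, h2⟩ := h
  have hinj : Set.InjOn φ U := by
    intro u hu v hv huv
    by_contra hne
    exact hU.prop hu hv hne (blowUp_adj.2 ⟨hne, Or.inl huv⟩)
  refine ⟨U.image φ, ⟨?_, fun S hS hle a ha => ?_⟩, ?_, ?_⟩
  · intro a ha b hb hab hadj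
    obtain ⟨u, hu, rfl⟩ := Finset.mem_image.1 (Finset.mem_coe.1 ha)
    obtain ⟨v, hv, rfl⟩ := Finset.mem_image.1 (Finset.mem_coe.1 hb)
    have huv : u ≠ v := fun h => hab (by rw [h])
    exact hU.prop (Finset.mem_coe.2 hu) (Finset.mem_coe.2 hv) huv
      (blowUp_adj.2 ⟨huv, Or.inr hadj⟩)
  · obtain ⟨v, rfl⟩ := hφ a
    by_cases hv : v ∈ U
    · exact Finset.mem_image_of_mem φ hv
    · obtain ⟨u, hu, hadj⟩ := hU.exists_adj_of_notMem hv
      rcases (blowUp_adj.1 hadj).2 with h | h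
      · rw [h]
        exact Finset.mem_image_of_mem φ hu
      · exact absurd h (hS (Finset.mem_coe.2 ha)
          (Finset.mem_coe.2 (hle (Finset.mem_image_of_mem φ hu))) h.ne)
  · rwa [Finset.card_image_of_injOn hinj]
  · rwa [Finset.card_image_of_injOn hinj]

end BlowUp

/-! ### Simulation on ball graphs -/

section Simulation

open Classical

variable {V : Type} {k : ℕ}

theorem active_congr {w w' : V → V → ℝ} {T : Fin k → V × V}
    (h : ∀ j, w (T j).1 (T j).2 = w' (T j).1 (T j).2) (τ : ℝ) : Active w T τ = Active w' T τ := by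
  funext v
  simp only [Active, h]

theorem unitLength_congr {w w' : V → V → ℝ} {T : Fin k → V × V}
    (h : ∀ j, w (T j).1 (T j).2 = w' (T j).1 (T j).2) : unitLength w T = unitLength w' T := by
  simp only [unitLength, maxPairDist, h]

/-- Active points represent themselves; all other points are represented by one fixed active
point. -/
noncomputable def representative (P : V → Prop) (v : V) : V :=
  if P v then v else if h : ∃ u, P u then h.choose else v

theorem representative_spec {P : V → Prop} (hP : ∃ u, P u) (v : V) : P (representative P v) := by
  unfold representative
  split_ifs with h
  · exact h
  · exact hP.choose_spec

theorem representative_of_mem {P : V → Prop} {v : V} (hv : P v) : representative P v = v :=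
  if_pos hv

/-- The map from the points to the vertices of the ball graph. -/
noncomputable def toActive {w : V → V → ℝ} {T : Fin k → V × V} {τ : ℝ}
    (h : ∃ v, Active w T τ v) (v : V) : {v : V // Active w T τ v} :=
  ⟨representative (Active w T τ) v, representative_spec h v⟩

theorem toActive_surjective {w : V → V → ℝ} {T : Fin k → V × V} {τ : ℝ}
    (h : ∃ v, Active w T τ v) : Function.Surjective (toActive h) := fun v =>
  ⟨v, Subtype.ext (representative_of_mem v.2)⟩

/-- Run a query algorithm for graphs on the blow-up of the ball graph at threshold `τ`; the set of
active points is computed from `W`. -/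
noncomputable def levelAlg (W : V → V → ℝ) (T : Fin k → V × V) (τ : ℝ) (D : QueryAlg V Bool ℝ) :
    QueryAlg V ℝ ℝ :=
  D.simulate (representative (Active W T τ)) fun u v a =>
    decide (u ≠ v ∧ (representative (Active W T τ) u = representative (Active W T τ) v ∨
      a < 2 * τ))

theorem adjOracle_blowUp_ballGraph [PseudoMetricSpace V] {T : Fin k → V × V} {τ : ℝ}
    (h : ∃ v, Active dist T τ v) (u v : V) :
    adjOracle (blowUp (ballGraph dist T τ) (toActive h)) u v =
      decide (u ≠ v ∧ (representative (Active dist T τ) u = representative (Active dist T τ) v ∨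
        dist (representative (Active dist T τ) u) (representative (Active dist T τ) v)
          < 2 * τ)) := by
  rw [adjOracle]
  congr 1
  rw [blowUp_adj, ballGraph, SimpleGraph.fromRel_adj, dist_comm (toActive h v).1, or_self]
  simp only [toActive, Subtype.mk.injEq, ne_eq, eq_iff_iff]
  tauto

theorem eval_levelAlg [PseudoMetricSpace V] {W : V → V → ℝ} {T : Fin k → V × V}
    (hW : ∀ j, W (T j).1 (T j).2 = dist (T j).1 (T j).2) {τ : ℝ} (h : ∃ v, Active dist T τ v)
    (D : QueryAlg V Bool ℝ) : (levelAlg W T τ D).eval dist =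
      D.eval (adjOracle (blowUp (ballGraph dist T τ) (toActive h))) := by
  rw [levelAlg, QueryAlg.eval_simulate, active_congr hW]
  congr 1
  funext u v
  rw [adjOracle_blowUp_ballGraph]

theorem queries_levelAlg [PseudoMetricSpace V] {W : V → V → ℝ} {T : Fin k → V × V}
    (hW : ∀ j, W (T j).1 (T j).2 = dist (T j).1 (T j).2) {τ : ℝ} (h : ∃ v, Active dist T τ v)
    (D : QueryAlg V Bool ℝ) : (levelAlg W T τ D).queries dist =
      D.queries (adjOracle (blowUp (ballGraph dist T τ) (toActive h))) := by
  rw [levelAlg, QueryAlg.queries_simulate, active_congr hW]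
  congr 1
  funext u v
  rw [adjOracle_blowUp_ballGraph]

/-- Run the algorithms `alg 0, …, alg (N - 1)` and form the sum of their results, weighted by
`τ`. -/
noncomputable def weightedSumAlg (alg : ℕ → QueryAlg V ℝ ℝ) (τ : ℕ → ℝ) : ℕ → QueryAlg V ℝ ℝ
  | 0 => .done 0
  | N + 1 => (weightedSumAlg alg τ N).bind fun S => (alg N).bind fun x => .done (S + x * τ N)

theorem eval_weightedSumAlg (O : V → V → ℝ) (alg : ℕ → QueryAlg V ℝ ℝ) (τ : ℕ → ℝ) (N : ℕ) :
    (weightedSumAlg alg τ N).eval O = ∑ i ∈ Finset.range N, (alg i).eval O * τ i := by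
  induction N with
  | zero => simp [weightedSumAlg, QueryAlg.eval]
  | succ N ih => simp [weightedSumAlg, QueryAlg.eval_bind, QueryAlg.eval, ih, Finset.sum_range_succ]

theorem queries_weightedSumAlg (O : V → V → ℝ) (alg : ℕ → QueryAlg V ℝ ℝ) (τ : ℕ → ℝ) (N : ℕ) :
    (weightedSumAlg alg τ N).queries O = ∑ i ∈ Finset.range N, (alg i).queries O := by
  induction N with
  | zero => simp [weightedSumAlg, QueryAlg.queries]
  | succ N ih =>
    simp [weightedSumAlg, QueryAlg.queries_bind, QueryAlg.queries, ih, Finset.sum_range_succ]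

/-- Read the distances of the pairs `T` and run `D` on the ball graphs of all levels. -/
noncomputable def forestTree (T : Fin k → V × V) (D : QueryAlg V Bool ℝ) : QueryAlg V ℝ ℝ :=
  (readAt (List.ofFn T) 0).bind fun W =>
    weightedSumAlg (fun i => levelAlg W T (threshold (unitLength W T) i) D)
      (threshold (unitLength W T)) (lastLevel k + 1)

variable [PseudoMetricSpace V] (T : Fin k → V × V)

theorem eval_readAt_pairs (j : Fin k) :
    (readAt (List.ofFn T) 0).eval dist (T j).1 (T j).2 = dist (T j).1 (T j).2 :=
  eval_readAt dist _ _ (T j) (List.mem_ofFn.2 ⟨j, rfl⟩)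

theorem eval_forestTree (h : ∀ i ∈ Finset.range (lastLevel k + 1),
      ∃ v, Active dist T (threshold (unitLength dist T) i) v) (D : QueryAlg V Bool ℝ) :
    (forestTree T D).eval dist = ∑ i ∈ (Finset.range (lastLevel k + 1)).attach,
      D.eval (adjOracle (blowUp (ballGraph dist T (threshold (unitLength dist T) i))
        (toActive (h i i.2)))) * threshold (unitLength dist T) i := by
  have hW := eval_readAt_pairs T
  rw [forestTree, QueryAlg.eval_bind, eval_weightedSumAlg, unitLength_congr hW,
    ← Finset.sum_attach]
  exact Finset.sum_congr rfl fun i _ => by rw [eval_levelAlg hW (h i i.2)]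

theorem queries_forestTree_le (h : ∀ i ∈ Finset.range (lastLevel k + 1),
      ∃ v, Active dist T (threshold (unitLength dist T) i) v) (D : QueryAlg V Bool ℝ) {q : ℕ}
    (hq : ∀ G, D.queries (adjOracle G) ≤ q) :
    (forestTree T D).queries dist ≤ k + (lastLevel k + 1) * q := by
  have hW := eval_readAt_pairs T
  rw [forestTree, QueryAlg.queries_bind, queries_weightedSumAlg, queries_readAt, List.length_ofFn,
    unitLength_congr hW]
  refine Nat.add_le_add_left ?_ k
  calc _ ≤ ∑ i ∈ Finset.range (lastLevel k + 1), q := Finset.sum_le_sum fun i hi => by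
        rw [queries_levelAlg hW (h i hi)]
        exact hq _
    _ = _ := by simp

end Simulation

/-! ### The algorithm for Steiner forests -/

section Algorithms

variable {n k : ℕ}

/-- Running the same random decision tree on all levels: the failure probabilities add up. -/
theorem failProb_forest_le (m : PseudoMetricSpace (Fin n)) (hk : 1 ≤ k)
    (T : Fin k → Fin n × Fin n) {c δ : ℝ} (hδ : 0 ≤ δ) {q : ℕ} {𝒜 : RandAlg (Fin n) Bool ℝ}
    (h𝒜 : EstimatesMIS c δ q 𝒜) :
    failProb (𝒜.map (forestTree T)) m.dist (IsBallEstimate c m.dist T) ≤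
      ENNReal.ofReal ((lastLevel k + 1 : ℕ) * δ) := by
  classical
  have hact : ∀ i ∈ Finset.range (lastLevel k + 1),
      ∃ v, Active m.dist T (threshold (unitLength m.dist T) i) v := fun i hi =>
    exists_active_of_le_lastLevel hk (fun u v => @dist_nonneg _ m u v) T
      (by rw [Finset.mem_range] at hi; omega)
  let H : {i // i ∈ Finset.range (lastLevel k + 1)} → SimpleGraph (Fin n) := fun i =>
    blowUp (ballGraph m.dist T (threshold (unitLength m.dist T) i)) (toActive (hact i i.2))
  calc _ ≤ ∑ i ∈ (Finset.range (lastLevel k + 1)).attach,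
        failProb 𝒜 (adjOracle (H i)) (IsMISEstimate c (H i)) := by
        simp only [failProb]
        rw [expect_map, ← expect_sum]
        refine expect_mono _ fun D _ => ?_
        by_cases hall : ∀ i, IsMISEstimate c (H i) (D.eval (adjOracle (H i)))
        · rw [if_pos]
          · exact zero_le
          · rw [@eval_forestTree _ _ m T hact D]
            refine ⟨fun i => if hi : i ∈ Finset.range (lastLevel k + 1) then
              D.eval (adjOracle (H ⟨i, hi⟩)) else 0, fun i hi => ?_, ?_⟩
            · simp only [hi, dif_pos]
              exact (hall ⟨i, hi⟩).of_blowUp (toActive_surjective _)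
            · rw [← Finset.sum_attach (Finset.range (lastLevel k + 1))]
              refine Finset.sum_congr rfl fun i _ => ?_
              simp only [i.2, dif_pos]
              rfl
        · push Not at hall
          obtain ⟨i, hi⟩ := hall
          calc _ ≤ (1 : ℝ≥0∞) := by split_ifs <;> simp
            _ = if IsMISEstimate c (H i) (D.eval (adjOracle (H i))) then 0 else 1 := by
                rw [if_neg hi]
            _ ≤ _ := Finset.single_le_sum
                (f := fun i => if IsMISEstimate c (H i) (D.eval (adjOracle (H i)))
                  then (0 : ℝ≥0∞) else 1) (fun _ _ => zero_le) (Finset.mem_attach _ i)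
    _ ≤ ∑ i ∈ (Finset.range (lastLevel k + 1)).attach, ENNReal.ofReal δ :=
        Finset.sum_le_sum fun i _ => (one_sub_le_prob_iff _ _ _ hδ).1 (h𝒜 (H i)).2
    _ = _ := by
        rw [Finset.sum_const, Finset.card_attach, Finset.card_range, nsmul_eq_mul,
          ENNReal.ofReal_mul (by positivity), ENNReal.ofReal_natCast]

/-- When there are more levels than points, the whole matrix can be read. -/
theorem exists_readAll {c : ℝ} (hc : 1 ≤ c) (T : Fin k → Fin n × Fin n) :
    ∃ D : QueryAlg (Fin n) ℝ ℝ, ∀ O : Fin n → Fin n → ℝ,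
      D.queries O = n * n ∧ IsBallEstimate c O T (D.eval O) := by
  classical
  choose F hF using fun W : Fin n → Fin n → ℝ => exists_isBallEstimate hc W T
  refine ⟨(readAt Finset.univ.toList 0).bind fun W => .done (F W), fun O => ⟨?_, ?_⟩⟩
  · simp [QueryAlg.queries_bind, QueryAlg.queries, queries_readAt]
  · have : (readAt (Finset.univ : Finset (Fin n × Fin n)).toList 0).eval O = O := by
      funext u v
      exact eval_readAt O _ _ (u, v) (by simp)
    rw [QueryAlg.eval_bind, this]
    exact hF O

theorem exists_forest_algorithm {c : ℝ} (hc : 1 < c) (κ d : ℕ) (hk : 1 ≤ k) (hkn : k ≤ κ * n)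
    (T : Fin k → Fin n × Fin n) :
    ∃ 𝒜 : RandAlg (Fin n) ℝ ℝ, ∀ m : PseudoMetricSpace (Fin n),
      𝒜.QueriesLE m.dist
        ((16 * κ * c + 6 + 48 * c) * (TMIS c (d + 1) n * Real.log (k + 1))) ∧
      failProb 𝒜 m.dist (IsBallEstimate c m.dist T) ≤ ENNReal.ofReal (1 / (n : ℝ) ^ d) := by
  classical
  have hn : 1 ≤ n := by
    rcases Nat.eq_zero_or_pos n with rfl | h
    · omega
    · exact h
  have hnR : (0 : ℝ) < n := by exact_mod_cast hn
  have hL := lastLevel_add_one_le hk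
  have hlow := le_TMIS hc d n
  have hT1 := one_le_TMIS c (d + 1) n
  have hlog := half_le_log_succ hk
  set Λ := Real.log ((k : ℝ) + 1)
  set t := TMIS c (d + 1) n with ht
  by_cases hsmall : lastLevel k + 1 ≤ n
  · obtain ⟨𝒜, h𝒜⟩ := exists_estimatesMIS_misComplexity hc (d + 1) hn
    refine ⟨𝒜.map (forestTree T), fun m => ⟨?_, ?_⟩⟩
    · intro D' hD'
      rw [PMF.mem_support_map_iff] at hD'
      obtain ⟨D, hD, rfl⟩ := hD'
      have h1 := @queries_forestTree_le _ _ m T (fun i hi =>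
        exists_active_of_le_lastLevel hk (fun u v => @dist_nonneg _ m u v) T
          (by rw [Finset.mem_range] at hi; omega)) D _
        (fun G => by exact_mod_cast (h𝒜 G).1 D hD)
      have h2 : ((forestTree T D).queries m.dist : ℝ) ≤ k + ((lastLevel k + 1 : ℕ) : ℝ) *
          misComplexity c (1 / (n : ℝ) ^ (d + 1)) n := by exact_mod_cast h1
      have h3 : (misComplexity c (1 / (n : ℝ) ^ (d + 1)) n : ℝ) ≤ t := le_max_right _ _
      have h4 : (k : ℝ) ≤ κ * n := by exact_mod_cast hkn
      have hκ : (0 : ℝ) ≤ κ := by positivity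
      calc ((forestTree T D).queries m.dist : ℝ)
          ≤ κ * (8 * c * t) + (6 * Λ) * t := by
            refine h2.trans (add_le_add (h4.trans (by gcongr)) ?_)
            gcongr
        _ ≤ κ * (8 * c * (t * (2 * Λ))) + (6 * Λ) * t := by
            have : t ≤ t * (2 * Λ) := le_mul_of_one_le_right (by linarith) (by linarith)
            gcongr
        _ = (16 * κ * c + 6) * (t * Λ) := by ring
        _ ≤ _ := mul_le_mul_of_nonneg_right (by linarith)
            (mul_nonneg (by linarith) (by linarith))
    · refine (failProb_forest_le m hk T (by positivity) h𝒜).trans (ENNReal.ofReal_le_ofReal ?_)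
      have : ((lastLevel k + 1 : ℕ) : ℝ) ≤ n := by exact_mod_cast hsmall
      calc ((lastLevel k + 1 : ℕ) : ℝ) * (1 / (n : ℝ) ^ (d + 1))
          ≤ n * (1 / (n : ℝ) ^ (d + 1)) := by gcongr
        _ = 1 / (n : ℝ) ^ d := by
            rw [pow_succ]
            field_simp
  · obtain ⟨D, hD⟩ := exists_readAll hc.le T
    refine ⟨PMF.pure D, fun m => ⟨?_, ?_⟩⟩
    · intro D' hD'
      rw [PMF.mem_support_pure_iff] at hD'
      rw [hD', (hD m.dist).1]
      have h1 : (n : ℝ) ≤ 6 * Λ := by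
        refine le_trans ?_ hL
        exact_mod_cast (not_le.1 hsmall).le
      push_cast
      calc (n : ℝ) * n ≤ (8 * c * t) * (6 * Λ) := by gcongr
        _ = (48 * c) * (t * Λ) := by ring
        _ ≤ _ := by
            have : (0 : ℝ) ≤ 16 * κ * c + 6 := by positivity
            exact mul_le_mul_of_nonneg_right (by linarith)
              (mul_nonneg (by linarith) (by linarith))
    · rw [failProb, expect_pure, if_pos (hD m.dist).2]
      exact zero_le

theorem TMIS_mul_log_le {c : ℝ} (hc : 1 < c) (κ d : ℕ) :
    ∃ C : ℝ, 0 < C ∧ ∀ n k : ℕ, 1 ≤ k → k ≤ κ * n →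
      TMIS c d n * Real.log (k + 1) ≤ C * (n : ℝ) ^ (3 / 2 : ℝ) * Real.log (n + 1) ^ 3 := by
  obtain ⟨C, hC, h⟩ := TMIS_le hc d
  refine ⟨C * (2 * κ + 1), by positivity, fun n k hk hkn => ?_⟩
  have hn : 1 ≤ n := by
    rcases Nat.eq_zero_or_pos n with rfl | h
    · omega
    · exact h
  have hΛ := half_le_log_succ hn
  have h1 : (k : ℝ) + 1 ≤ (κ + 1) * (n + 1) := by
    have : (k : ℝ) ≤ κ * n := by exact_mod_cast hkn
    have : (0 : ℝ) ≤ κ := by positivity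
    have : (0 : ℝ) ≤ n := by positivity
    linarith
  have h2 : Real.log (k + 1) ≤ (2 * κ + 1) * Real.log (n + 1) := by
    have h3 := Real.log_le_log (by positivity) h1
    rw [Real.log_mul (by positivity) (by positivity)] at h3
    have h4 := Real.log_le_sub_one_of_pos (x := (κ : ℝ) + 1) (by positivity)
    have : (0 : ℝ) ≤ κ := by positivity
    nlinarith
  have h0 : 0 ≤ TMIS c d n := le_trans zero_le_one (one_le_TMIS c d n)
  calc _ ≤ (C * (n : ℝ) ^ (3 / 2 : ℝ) * Real.log (n + 1) ^ 2) *
        ((2 * κ + 1) * Real.log (n + 1)) := by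
        have := Real.log_nonneg (x := (k : ℝ) + 1) (by linarith [k.cast_nonneg (α := ℝ)])
        gcongr
        exact h n hn
    _ = _ := by ring

end Algorithms

end SteinerForest

theorem theorem1 :
    -- the sandwich for the sizes of arbitrary maximal independent sets of the ball graphs
    (∀ (n k : ℕ) (T : Fin k → Fin n × Fin n) (m : PseudoMetricSpace (Fin n)) (σ : ℝ) (L : ℕ)
        (U : (i : ℕ) →
          Finset {v : Fin n // SteinerForest.Active m.dist T (SteinerForest.threshold σ i) v}),
      0 < σ →
      (∀ i ≤ L, SteinerForest.IsMIS
        (SteinerForest.ballGraph m.dist T (SteinerForest.threshold σ i)) (U i)) →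
      (∀ i ≤ L, (U i).card * SteinerForest.threshold σ i ≤ SteinerForest.opt m.dist T) ∧
      ((∀ j, m.dist (T j).1 (T j).2 < SteinerForest.threshold σ (L + 1)) →
        ((∀ u v, u ≠ v → SteinerForest.Active m.dist T σ u → SteinerForest.Active m.dist T σ v →
              2 * σ ≤ m.dist u v) ∧
            (∀ j, (T j).1 ≠ (T j).2 → σ ≤ m.dist (T j).1 (T j).2) ∨
          (∃ j, 4 * k * σ ≤ m.dist (T j).1 (T j).2)) →
        SteinerForest.opt m.dist T
          ≤ 6 * ∑ i ∈ Finset.range (L + 1), (U i).card * SteinerForest.threshold σ i)) ∧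
    -- the algorithm
    (∃ A : ℝ, 0 < A ∧
      ∀ (c : ℝ), 1 < c → ∀ (κ d : ℕ), ∃ (C : ℝ) (a : ℕ), 0 < C ∧
        ∀ (n k : ℕ), 1 ≤ k → k ≤ κ * n →
          SteinerForest.TMIS c (d + 1) n * Real.log (k + 1)
              ≤ C * (n : ℝ) ^ (3 / 2 : ℝ) * Real.log (n + 1) ^ a ∧
          ∀ T : Fin k → Fin n × Fin n, ∃ 𝒜 : SteinerForest.RandAlg (Fin n) ℝ ℝ,
            ∀ m : PseudoMetricSpace (Fin n),
              𝒜.QueriesLE m.dist (C * (SteinerForest.TMIS c (d + 1) n * Real.log (k + 1))) ∧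
              1 - 1 / (n : ℝ) ^ d ≤ 𝒜.prob m.dist (fun x =>
                SteinerForest.IsBallEstimate c m.dist T x ∧
                SteinerForest.opt m.dist T ≤ 6 * x ∧
                x ≤ A * c * Real.log (k + 1) * SteinerForest.opt m.dist T)) := by
  refine ⟨fun n k T m σ L U hσ hU => ⟨fun i hi => ?_, fun hL hab => ?_⟩, 6, by norm_num,
    fun c hc κ d => ?_⟩
  · exact @SteinerForest.card_mul_le_opt _ _ _ m T _ (SteinerForest.threshold_pos hσ i) (U i)
      (hU i hi).prop
  · rcases hab with ⟨hsep, hT⟩ | hfar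
    · exact @SteinerForest.opt_le_of_separated _ _ _ m T σ hσ L U hU hL hsep hT
    · exact @SteinerForest.opt_le_of_far_pair _ _ _ m T σ hσ L U hU hL hfar
  · obtain ⟨C, hC, hTMIS⟩ := SteinerForest.TMIS_mul_log_le hc κ (d + 1)
    refine ⟨C + (16 * κ * c + 6 + 48 * c), 3, by positivity, fun n k hk hkn => ⟨?_, fun T => ?_⟩⟩
    · refine (hTMIS n k hk hkn).trans ?_
      have := SteinerForest.one_le_TMIS c d n
      have := Real.log_nonneg (x := (n : ℝ) + 1) (by linarith [n.cast_nonneg (α := ℝ)])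
      gcongr
      have : (0 : ℝ) ≤ 16 * κ * c + 6 + 48 * c := by positivity
      linarith
    · obtain ⟨𝒜, h𝒜⟩ := SteinerForest.exists_forest_algorithm hc κ d hk hkn T
      refine ⟨𝒜, fun m => ⟨fun D hD => ((h𝒜 m).1 D hD).trans ?_, ?_⟩⟩
      · have h1 := SteinerForest.one_le_TMIS c (d + 1) n
        have h2 := Real.log_nonneg (x := (k : ℝ) + 1) (by linarith [k.cast_nonneg (α := ℝ)])
        have h3 : 0 < 16 * κ * c + 6 + 48 * c := by positivity
        exact mul_le_mul_of_nonneg_right (by linarith) (mul_nonneg (by linarith) h2)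
      · rw [SteinerForest.one_sub_le_prob_iff _ _ _ (by positivity)]
        refine le_trans (SteinerForest.expect_mono _ fun D _ => ?_) (h𝒜 m).2
        split_ifs with h1 h2 h2
        · exact zero_le
        · exact zero_le
        · exact absurd ⟨h2, @SteinerForest.IsBallEstimate.opt_le_and_le _ _ _ m hk c hc T _ h2⟩ h1
        · exact le_rfl
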